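/- Let $I=\{1,\dots,n\}$, let $C=(C_{i,j})_{i,j\in I}$ be a generalized Cartan matrix (integer entries, $C_{i,i}=2$, $C_{i,j}\le 0$ for $i\ne j$, and $C_{i,j}=0\Leftrightarrow C_{j,i}=0$), and let $r_i\ge 1$ $(i\in I)$ be integers. For $l\in\mathbb Z$ put $[l]_z=\frac{z^l-z^{-l}}{z-z^{-1}}\in\mathbb Z[z^{\pm1}]$, let $C_{i,i}(z)=z^{r_i}+z^{-r_i}$, $C_{i,j}(z)=[C_{i,j}]_z$ for $i\neq j$, and $B_{i,j}(z)=[r_i]_z\,C_{i,j}(z)$. Suppose that the matrix $B(z)$ is symmetric. Let $q\in\mathbb C^*$; put $s=0$ if $q$ is not a root of unity, and otherwise let $s\ge 1$ be such that $q$ is a primitive $s$-th root of unity. Let $\hat{\mathcal H}$ be the $\mathbb C$-algebra with generators $a_i[m],y_i[m]$ $(i\in I,\ m\in\mathbb Z\setminus\{0\})$ and central generators $c_p$ $(p>0)$, and relations $$[a_i[m],a_j[p]]=\delta_{m,-p}(q^m-q^{-m})B_{i,j}(q^m)c_{|m|},\quad [a_i[m],y_j[p]]=\delta_{m,-p}\delta_{i,j}(q^{mr_i}-q^{-mr_i})c_{|m|},\quad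 [y_i[m],y_j[p]]=0 .$$ In $\hat{\mathcal H}[[h]]$ define, for $i\in I$ and $l\in\mathbb Z/s\mathbb Z$, the invertible elements $$\tilde Y_{i,l}=\exp\Big(\sum_{m>0}h^mq^{lm}y_i[m]\Big)\exp\Big(\sum_{m>0}h^mq^{-lm}y_i[-m]\Big),$$ $$\tilde A_{i,l}=\exp\Big(\sum_{m>0}h^mq^{lm}a_i[m]\Big)\exp\Big(\sum_{m>0}h^mq^{-lm}a_i[-m]\Big),\qquad t_l=\exp\Big(\sum_{m>0}h^{2m}q^{lm}c_m\Big).$$ Let $\hat{\mathcal Y}_u^s\subset\hat{\mathcal H}[[h]]$ be the $\mathbb Z$-subalgebra generated by all $\tilde Y_{i,l}$, $\tilde A_{i,l}^{-1}$ and $t_l^{\pm1}$, and let $\hat{\mathcal Y}_t^s$ be the quotient of $\hat{\mathcal Y}_u^s$ by the relations $t_l=1$ for $l\in\mathbb Z/s\mathbb Z\setminus\{0\}$. Denote the images of $\tilde Y_{i,l},\tilde A_{i,l}^{-1}$ in $\hat{\mathcal Y}_t^s$ by the same symbols, and write $t^{\pm 1}$ for the image of $t_0^{\pm1}$. **Theorem.**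 The ring $\hat{\mathcal Y}_t^s$ is presented by the generators $\tilde Y_{i,l},\tilde A_{i,l}^{-1}$ $(i\in I,\ l\in\mathbb Z/s\mathbb Z)$ and $t,t^{-1}$, with the relations $tt^{-1}=t^{-1}t=1$, $t$ is central, and, for $i,j\in I$ and $k,l\in\mathbb Z/s\mathbb Z$, $$\tilde Y_{i,l}\tilde Y_{j,k}=\tilde Y_{j,k}\tilde Y_{i,l},\qquad \tilde A_{i,l}^{-1}\tilde A_{j,k}^{-1}=t^{\alpha(i,l,j,k)}\tilde A_{j,k}^{-1}\tilde A_{i,l}^{-1},\qquad \tilde Y_{j,k}\tilde A_{i,l}^{-1}=t^{\beta(i,l,j,k)}\tilde A_{i,l}^{-1}\tilde Y_{j,k},$$ where, with $\delta$ the Kronecker delta on $\mathbb Z/s\mathbb Z$, $$\alpha(i,l,i,k)=2(\delta_{l-k,-2r_i}-\delta_{l-k,2r_i}),$$ $$\alpha(i,l,j,k)=2\sum_{p=C_{i,j}+1,\,C_{i,j}+3,\dots,-C_{i,j}-1}(\delta_{l-k,p+r_i}-\delta_{l-k,p-r_i})\quad(i\ne j),$$ $$\beta(i,l,j,k)=2\delta_{i,j}(-\delta_{l-k,r_i}+\delta_{l-k,-r_i}).$$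 That is, the ring abstractly defined by these generators and relations is isomorphic to $\hat{\mathcal Y}_t^s$ by an isomorphism sending each generator to the element of the same name. -/

import Mathlib

open scoped LaurentPolynomial PowerSeries

namespace TDeformed

noncomputable section

/-! ### Cartan matrices and their quantum versions -/

/-- Generalized Cartan matrices. -/
structure IsGenCartan {n : ℕ} (C : Matrix (Fin n) (Fin n) ℤ) : Prop where
  diag : ∀ i, C i i = 2
  offdiag : ∀ i j, i ≠ j → C i j ≤ 0
  zero_iff : ∀ i j, C i j = 0 ↔ C j i = 0

/-- The quantum integer `[l]_z = (z ^ l - z ^ (-l)) / (z - z⁻¹)`, `l ∈ ℤ`, written as the Laurent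
polynomial `sign l * (z ^ (|l| - 1) + z ^ (|l| - 3) + ⋯ + z ^ (1 - |l|))`. -/
def qInt (l : ℤ) : ℤ[T;T⁻¹] :=
  l.sign • ∑ k ∈ Finset.range l.natAbs, LaurentPolynomial.T ((l.natAbs : ℤ) - 1 - 2 * (k : ℤ))

/-- The matrix `C(z)`: `C_{i,i}(z) = z_i + z_i⁻¹` with `z_i = z ^ r_i`, and
`C_{i,j}(z) = [C_{i,j}]_z` for `i ≠ j`. -/
def cartanZ {n : ℕ} (C : Matrix (Fin n) (Fin n) ℤ) (r : Fin n → ℕ) :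
    Matrix (Fin n) (Fin n) ℤ[T;T⁻¹] :=
  Matrix.of fun i j =>
    if i = j then LaurentPolynomial.T (r i : ℤ) + LaurentPolynomial.T (-(r i : ℤ))
    else qInt (C i j)

/-- The matrix `B(z) = D(z) C(z)`, where `D(z)` is diagonal with entries `[r_i]_z`. -/
def symZ {n : ℕ} (C : Matrix (Fin n) (Fin n) ℤ) (r : Fin n → ℕ) :
    Matrix (Fin n) (Fin n) ℤ[T;T⁻¹] :=
  Matrix.diagonal (fun i => qInt (r i : ℤ)) * cartanZ C r

/-- The value `P(x) ∈ ℂ` of an integral Laurent polynomial `P` at `x ∈ ℂ*`. -/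
def evalAt (x : ℂˣ) (P : ℤ[T;T⁻¹]) : ℂ :=
  LaurentPolynomial.eval₂ (Int.castRingHom ℂ) x P

/-! ### The Heisenberg algebra -/

/-- The generators `a_i[m]`, `y_i[m]` (`m ∈ ℤ - {0}`) and `c_p` (`p > 0`). -/
inductive HeisGen (n : ℕ) : Type
  | a (i : Fin n) (m : {m : ℤ // m ≠ 0}) : HeisGen n
  | y (i : Fin n) (m : {m : ℤ // m ≠ 0}) : HeisGen n
  | c (p : ℕ+) : HeisGen n

/-- A generator, as an element of the free algebra over `ℂ`. -/
def HeisGen.ι {n : ℕ} (g : HeisGen n) : FreeAlgebra ℂ (HeisGen n) := FreeAlgebra.ι ℂ g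

/-- `c_{|m|}` for a nonzero integer `m`. -/
def HeisGen.cAbs {n : ℕ} (m : {m : ℤ // m ≠ 0}) : HeisGen n :=
  HeisGen.c ⟨m.1.natAbs, Int.natAbs_pos.2 m.2⟩

/-- The defining relations of the Heisenberg algebra (`⁅x, y⁆ = x * y - y * x`). -/
inductive HeisRel {n : ℕ} (C : Matrix (Fin n) (Fin n) ℤ) (r : Fin n → ℕ) (q : ℂˣ) :
    FreeAlgebra ℂ (HeisGen n) → FreeAlgebra ℂ (HeisGen n) → Prop
  | central (p : ℕ+) (g : HeisGen n) :
      HeisRel C r q ((HeisGen.c p).ι * g.ι) (g.ι * (HeisGen.c p).ι)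
  | aa (i j : Fin n) (m p : {m : ℤ // m ≠ 0}) :
      HeisRel C r q ⁅(HeisGen.a i m).ι, (HeisGen.a j p).ι⁆
        (if m.1 = -p.1 then
          ((((q ^ m.1 : ℂˣ) : ℂ) - ((q ^ (-m.1) : ℂˣ) : ℂ)) * evalAt (q ^ m.1) (symZ C r i j)) •
            (HeisGen.cAbs m).ι
         else 0)
  | ay (i j : Fin n) (m p : {m : ℤ // m ≠ 0}) :
      HeisRel C r q ⁅(HeisGen.a i m).ι, (HeisGen.y j p).ι⁆
        (if m.1 = -p.1 ∧ i = j then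
          (((q ^ (m.1 * (r i : ℤ)) : ℂˣ) : ℂ) - ((q ^ (-(r i : ℤ) * m.1) : ℂˣ) : ℂ)) •
            (HeisGen.cAbs m).ι
         else 0)
  | yy (i j : Fin n) (m p : {m : ℤ // m ≠ 0}) :
      HeisRel C r q ⁅(HeisGen.y i m).ι, (HeisGen.y j p).ι⁆ 0

/-- The Heisenberg algebra, by generators and relations over `ℂ`. -/
abbrev Heis {n : ℕ} (C : Matrix (Fin n) (Fin n) ℤ) (r : Fin n → ℕ) (q : ℂˣ) : Type :=
  RingQuot (HeisRel C r q)

/-- The image of a generator in the Heisenberg algebra. -/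
def Heis.of {n : ℕ} (C : Matrix (Fin n) (Fin n) ℤ) (r : Fin n → ℕ) (q : ℂˣ) (g : HeisGen n) :
    Heis C r q :=
  RingQuot.mkAlgHom ℂ (HeisRel C r q) g.ι

/-! ### Formal power series in the central variable `h` -/

/-- `exp f = ∑_k f ^ k / k!` for a formal power series `f` without constant term over a possibly
noncommutative `ℂ`-algebra (the terms with `k > d` do not contribute to the coefficient of
`h ^ d`). -/
def expSeries {R : Type*} [Ring R] [Algebra ℂ R] (f : R⟦X⟧) : R⟦X⟧ :=
  PowerSeries.mk fun d =>
    ∑ k ∈ Finset.range (d + 1), ((Nat.factorial k : ℂ)⁻¹) • PowerSeries.coeff d (f ^ k)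

theorem constantCoeff_expSeries {R : Type*} [Ring R] [Algebra ℂ R] (f : R⟦X⟧) :
    PowerSeries.constantCoeff (expSeries f) = 1 := by
  rw [← PowerSeries.coeff_zero_eq_constantCoeff_apply]
  simp [expSeries]

/-- A power series with constant term `1`, as an invertible element. -/
def unitOf {R : Type*} [Ring R] (f : R⟦X⟧) (hf : PowerSeries.constantCoeff f = 1) : R⟦X⟧ˣ where
  val := f
  inv := PowerSeries.invOfUnit f 1
  val_inv := PowerSeries.mul_invOfUnit f 1 (by simpa using hf)
  inv_val := PowerSeries.invOfUnit_mul f 1 (by simpa using hf)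

section Currents

variable {n : ℕ} (C : Matrix (Fin n) (Fin n) ℤ) (r : Fin n → ℕ) (q : ℂˣ)

/-- `∑_{m > 0} h ^ m q ^ (l m) x[m]`. -/
def posSum (x : {m : ℤ // m ≠ 0} → Heis C r q) (l : ℤ) : (Heis C r q)⟦X⟧ :=
  PowerSeries.mk fun m =>
    if hm : m = 0 then 0
    else ((q ^ (l * (m : ℤ)) : ℂˣ) : ℂ) • x ⟨(m : ℤ), by exact_mod_cast hm⟩

/-- `∑_{m > 0} h ^ m q ^ (-l m) x[-m]`. -/
def negSum (x : {m : ℤ // m ≠ 0} → Heis C r q) (l : ℤ) : (Heis C r q)⟦X⟧ :=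
  PowerSeries.mk fun m =>
    if hm : m = 0 then 0
    else ((q ^ (-l * (m : ℤ)) : ℂˣ) : ℂ) • x ⟨-(m : ℤ), by simpa using hm⟩

/-- `∑_{m > 0} h ^ (2 m) q ^ (l m) c_m`. -/
def cSum (l : ℤ) : (Heis C r q)⟦X⟧ :=
  PowerSeries.mk fun d =>
    if hd : 0 < d / 2 ∧ Even d then
      ((q ^ (l * ((d / 2 : ℕ) : ℤ)) : ℂˣ) : ℂ) • Heis.of C r q (HeisGen.c ⟨d / 2, hd.1⟩)
    else 0

/-- `Ỹ_{i,l}`, `l ∈ ℤ`. -/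
def Ytilde (i : Fin n) (l : ℤ) : (Heis C r q)⟦X⟧ˣ :=
  unitOf (expSeries (posSum C r q (fun m => Heis.of C r q (HeisGen.y i m)) l) *
      expSeries (negSum C r q (fun m => Heis.of C r q (HeisGen.y i m)) l))
    (by rw [map_mul, constantCoeff_expSeries, constantCoeff_expSeries, mul_one])

/-- `Ã_{i,l}`, `l ∈ ℤ`. -/
def Atilde (i : Fin n) (l : ℤ) : (Heis C r q)⟦X⟧ˣ :=
  unitOf (expSeries (posSum C r q (fun m => Heis.of C r q (HeisGen.a i m)) l) *
      expSeries (negSum C r q (fun m => Heis.of C r q (HeisGen.a i m)) l))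
    (by rw [map_mul, constantCoeff_expSeries, constantCoeff_expSeries, mul_one])

/-- `t_l`, `l ∈ ℤ`. -/
def tSeries (l : ℤ) : (Heis C r q)⟦X⟧ˣ :=
  unitOf (expSeries (cSum C r q l)) (constantCoeff_expSeries _)

end Currents

/-- If `q` is a primitive `s`-th root of unity, the powers `q ^ (l m)`, and hence `Ỹ_{i,l}`,
`Ã_{i,l}` and `t_l`, depend on the integer `l` only through its class modulo `s`. Below, an index
in `ℤ/sℤ` is replaced by an arbitrary integer representative (itself when `s = 0`). -/
theorem zpow_mul_eq_of_cast_eq {q : ℂˣ} {s : ℕ} (hs : IsPrimitiveRoot q s) {l l' : ℤ}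
    (h : (l : ZMod s) = (l' : ZMod s)) (m : ℤ) : q ^ (l * m) = q ^ (l' * m) := by
  obtain ⟨k, hk⟩ := (ZMod.intCast_eq_intCast_iff_dvd_sub l l' s).1 h
  obtain rfl : l' = l + s * k := by omega
  rw [zpow_mul, zpow_mul, zpow_add, zpow_mul q (s : ℤ) k, zpow_natCast, hs.pow_eq_one, one_zpow,
    mul_one]

/-! ### The algebras `Ŷ_u^s` and `Ŷ_t^s` -/

section Subquotient

variable {n : ℕ} (C : Matrix (Fin n) (Fin n) ℤ) (r : Fin n → ℕ) (q : ℂˣ) (s : ℕ)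

/-- The `ℤ`-subalgebra of the algebra of power series generated by the `Ỹ_{i,l}`, `Ã_{i,l}⁻¹` and
`t_l^{±1}`, `l ∈ ℤ/sℤ`. -/
def Yu : Subring (Heis C r q)⟦X⟧ :=
  Subring.closure
    ({x | ∃ (i : Fin n) (l : ZMod s), x = ↑(Ytilde C r q i l.cast)} ∪
     {x | ∃ (i : Fin n) (l : ZMod s), x = ↑((Atilde C r q i l.cast)⁻¹)} ∪
     {x | ∃ l : ZMod s, x = ↑(tSeries C r q l.cast)} ∪
     {x | ∃ l : ZMod s, x = ↑((tSeries C r q l.cast)⁻¹)})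

/-- `Ỹ_{i,l}` in `Ŷ_u^s`. -/
def Yu.Y (i : Fin n) (l : ZMod s) : Yu C r q s :=
  ⟨↑(Ytilde C r q i l.cast), Subring.subset_closure (Or.inl (Or.inl (Or.inl ⟨i, l, rfl⟩)))⟩

/-- `Ã_{i,l}⁻¹` in `Ŷ_u^s`. -/
def Yu.Ainv (i : Fin n) (l : ZMod s) : Yu C r q s :=
  ⟨↑((Atilde C r q i l.cast)⁻¹), Subring.subset_closure (Or.inl (Or.inl (Or.inr ⟨i, l, rfl⟩)))⟩

/-- `t_l` in `Ŷ_u^s`. -/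
def Yu.t (l : ZMod s) : Yu C r q s :=
  ⟨↑(tSeries C r q l.cast), Subring.subset_closure (Or.inl (Or.inr ⟨l, rfl⟩))⟩

/-- `t_l⁻¹` in `Ŷ_u^s`. -/
def Yu.tInv (l : ZMod s) : Yu C r q s :=
  ⟨↑((tSeries C r q l.cast)⁻¹), Subring.subset_closure (Or.inr ⟨l, rfl⟩)⟩

/-- The relations `t_l = 1` for `l ∈ ℤ/sℤ - {0}`. -/
inductive YtRel : Yu C r q s → Yu C r q s → Prop
  | t_eq_one (l : ZMod s) (hl : l ≠ 0) : YtRel (Yu.t C r q s l) 1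

/-- `Ŷ_t^s`, the quotient of `Ŷ_u^s` by the relations `t_l = 1`, `l ≠ 0`. -/
abbrev Yt : Type := RingQuot (YtRel C r q s)

/-- The projection of `Ŷ_u^s` onto `Ŷ_t^s`. -/
def Yt.proj : Yu C r q s →+* Yt C r q s := RingQuot.mkRingHom (YtRel C r q s)

end Subquotient

/-! ### The presented algebra -/

/-- `δ_{a,b}` for `a, b ∈ ℤ/sℤ`. -/
def delta {s : ℕ} (a b : ZMod s) : ℤ := if a = b then 1 else 0

/-- The exponent `α(i,l,j,k)`. For `i ≠ j` the sum runs over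
`p = C_{i,j} + 1, C_{i,j} + 3, …, -C_{i,j} - 1` (so it is empty if `C_{i,j} = 0`). -/
def alpha {n : ℕ} (C : Matrix (Fin n) (Fin n) ℤ) (r : Fin n → ℕ) (s : ℕ)
    (i : Fin n) (l : ZMod s) (j : Fin n) (k : ZMod s) : ℤ :=
  if i = j then
    2 * (delta (l - k) ((-2 * (r i : ℤ) : ℤ) : ZMod s) - delta (l - k) ((2 * (r i : ℤ) : ℤ) : ZMod s))
  else
    2 * ∑ e ∈ Finset.range (-C i j).toNat,
      (delta (l - k) ((C i j + 1 + 2 * (e : ℤ) + (r i : ℤ) : ℤ) : ZMod s) -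
        delta (l - k) ((C i j + 1 + 2 * (e : ℤ) - (r i : ℤ) : ℤ) : ZMod s))

/-- The exponent `β(i,l,j,k)`. -/
def beta {n : ℕ} (r : Fin n → ℕ) (s : ℕ)
    (i : Fin n) (l : ZMod s) (j : Fin n) (k : ZMod s) : ℤ :=
  2 * (if i = j then 1 else 0) *
    (-delta (l - k) ((r i : ℤ) : ZMod s) + delta (l - k) ((-(r i : ℤ) : ℤ) : ZMod s))

/-- The abstract generators `Ỹ_{i,l}`, `Ã_{i,l}⁻¹`, `t`, `t⁻¹`. -/
inductive PresGen (n s : ℕ) : Type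
  | Y (i : Fin n) (l : ZMod s) : PresGen n s
  | Ainv (i : Fin n) (l : ZMod s) : PresGen n s
  | t : PresGen n s
  | tInv : PresGen n s

/-- A generator, as an element of the free ring. -/
def PresGen.ι {n s : ℕ} (g : PresGen n s) : FreeAlgebra ℤ (PresGen n s) := FreeAlgebra.ι ℤ g

/-- `t ^ e` for `e ∈ ℤ`, as a word in `t` or `t⁻¹`. -/
def PresGen.tPow {n s : ℕ} (e : ℤ) : FreeAlgebra ℤ (PresGen n s) :=
  if 0 ≤ e then (PresGen.t : PresGen n s).ι ^ e.toNat
  else (PresGen.tInv : PresGen n s).ι ^ (-e).toNat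

/-- The defining relations: `t` is invertible with inverse `t⁻¹` and central, together with the
`t`-commutation relations. -/
inductive PresRel {n : ℕ} (C : Matrix (Fin n) (Fin n) ℤ) (r : Fin n → ℕ) (s : ℕ) :
    FreeAlgebra ℤ (PresGen n s) → FreeAlgebra ℤ (PresGen n s) → Prop
  | t_mul_tInv : PresRel C r s (PresGen.t.ι * PresGen.tInv.ι) 1
  | tInv_mul_t : PresRel C r s (PresGen.tInv.ι * PresGen.t.ι) 1
  | t_central (g : PresGen n s) : PresRel C r s (PresGen.t.ι * g.ι) (g.ι * PresGen.t.ι)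
  | YY (i j : Fin n) (l k : ZMod s) :
      PresRel C r s ((PresGen.Y i l).ι * (PresGen.Y j k).ι)
        ((PresGen.Y j k).ι * (PresGen.Y i l).ι)
  | AA (i j : Fin n) (l k : ZMod s) :
      PresRel C r s ((PresGen.Ainv i l).ι * (PresGen.Ainv j k).ι)
        (PresGen.tPow (alpha C r s i l j k) * (PresGen.Ainv j k).ι * (PresGen.Ainv i l).ι)
  | YA (i j : Fin n) (l k : ZMod s) :
      PresRel C r s ((PresGen.Y j k).ι * (PresGen.Ainv i l).ι)
        (PresGen.tPow (beta r s i l j k) * (PresGen.Ainv i l).ι * (PresGen.Y j k).ι)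

/-- The ring given by these generators and relations. -/
abbrev Pres {n : ℕ} (C : Matrix (Fin n) (Fin n) ℤ) (r : Fin n → ℕ) (s : ℕ) : Type :=
  RingQuot (PresRel C r s)

/-- The image of a generator in the presented ring. -/
def Pres.of {n : ℕ} (C : Matrix (Fin n) (Fin n) ℤ) (r : Fin n → ℕ) (s : ℕ) (g : PresGen n s) :
    Pres C r s :=
  RingQuot.mkRingHom (PresRel C r s) g.ι

end

end TDeformed

/-!
The relations hold by the formula `e^f e^g = e^{[f,g]} e^g e^f` for a central commutator `[f, g]`:
two currents commute up to the exponential of `∑_m h^{2m} G(q^m) c_m`, where `G` is an explicit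
integral Laurent polynomial, and this is the monomial `∏_l t_l^{κ_l}` whose exponents `κ` are the
coefficients of `G` with the powers of `z` reduced modulo `s` (`current_mul_current_eq_tMonomial`).
The exponent `κ_0` is all that is left in `Ŷ_t^s`; it equals `α` or `β` (`commExp_inr_inr`,
`commExp_inr_inl`).

That there are no further relations amounts to constructing the inverse, a map from `Ŷ_u^s` to the
presented ring that sends `t_0` to `t` and the other `t_l` to `1`. The ring `Ŷ_u^s` is spanned by
monomials `t^κ w` with `w` a word in the `Ỹ_{i,l}` and `Ã_{i,l}⁻¹`, so it has to be shown that a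
`ℤ`-linear relation between such monomials also holds in the presented ring
(`lift_tSpecial_eq_zero`). Two independence arguments, both based on Dedekind's lemma on characters,
give this.

* Adding scalars `θ` to the positive modes is an endomorphism of the Heisenberg algebra. Each
  monomial is an eigenvector, with an eigenvalue in `ℂ[[h]]` that is a character of the group of
  all `θ` and determines the multiset of letters of the word (`injective_wordChar`). A relation
  therefore splits into relations between words with the same letters. Such words differ by a factor
  `t^κ`, found by the same sequence of transpositions in `Ŷ_u^s` and in the presented ring
  (`exists_prod_eq_of_perm`).
* It remains to see that the monomials `t^κ` are linearly independent. For every sequence `γ` of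
  scalars the Heisenberg algebra acts on a Fock space with `c_p` acting as `γ_p`
  (`Heis.exists_fock`). There `t^κ` acts as a scalar in `ℂ[[h]]` that is a character of the group of
  all `γ`, and different `κ` give different characters (`linearIndependent_tMonomial`).

In both arguments the characters are distinguished by the linear independence of the functions
`m ↦ q^{lm}`, `m > 0`, for distinct `l ∈ ℤ/sℤ` (`eq_zero_of_powerSums_eq_zero`).
-/

namespace TDeformed

/-! ### Exponentials of power series over a noncommutative algebra -/

section Exp

open PowerSeries

variable {R R' : Type*} [Ring R] [Ring R']

theorem coeff_pow_eq_zero {f : R⟦X⟧} (hf : constantCoeff f = 0) {d k : ℕ} (h : d < k) :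
    coeff d (f ^ k) = 0 :=
  coeff_of_lt_order _
    (lt_of_lt_of_le (by exact_mod_cast h) (le_order_pow_of_constantCoeff_eq_zero k hf))

theorem coeff_mul_congr {x x' y y' : R⟦X⟧} {d : ℕ} (hx : ∀ e ≤ d, coeff e x = coeff e x')
    (hy : ∀ e ≤ d, coeff e y = coeff e y') : coeff d (x * y) = coeff d (x' * y') := by
  rw [coeff_mul, coeff_mul]
  refine Finset.sum_congr rfl fun p hp => ?_
  have := Finset.HasAntidiagonal.mem_antidiagonal.1 hp
  rw [hx _ (by omega), hy _ (by omega)]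

variable [Algebra ℂ R] [Algebra ℂ R']

/-- The sum of the first `N` terms of the exponential series of `f`. -/
noncomputable def expTrunc (N : ℕ) (f : R⟦X⟧) : R⟦X⟧ :=
  ∑ k ∈ Finset.range N, ((Nat.factorial k : ℂ)⁻¹) • f ^ k

theorem coeff_expSeries {f : R⟦X⟧} (hf : constantCoeff f = 0) {d N : ℕ} (h : d < N) :
    coeff d (expSeries f) = coeff d (expTrunc N f) := by
  rw [expSeries, coeff_mk, expTrunc, map_sum]
  simp only [coeff_smul]
  refine Finset.sum_subset (by simpa using Nat.succ_le_of_lt h) fun k _ hk => ?_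
  rw [coeff_pow_eq_zero hf (by simpa using hk), smul_zero]

/-- Conjugation is compatible with the exponential; `u` need not be invertible. -/
theorem expSeries_intertwine {f f' u : R⟦X⟧} (hf : constantCoeff f = 0)
    (hf' : constantCoeff f' = 0) (h : f * u = u * f') :
    expSeries f * u = u * expSeries f' := by
  ext d
  rw [coeff_mul_congr (x' := expTrunc (d + 1) f) (y' := u)
      (fun e he => coeff_expSeries hf (by omega)) (fun _ _ => rfl),
    coeff_mul_congr (x := u) (x' := u) (y' := expTrunc (d + 1) f') (fun _ _ => rfl)
      (fun e he => coeff_expSeries hf' (by omega))]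
  congr 1
  rw [expTrunc, expTrunc, Finset.sum_mul, Finset.mul_sum]
  refine Finset.sum_congr rfl fun k _ => ?_
  have hk : f ^ k * u = u * f' ^ k :=
    ((show SemiconjBy u f' f from h.symm).pow_right k).symm
  rw [smul_mul_assoc, mul_smul_comm, hk]

theorem commute_expSeries {f u : R⟦X⟧} (hf : constantCoeff f = 0) (h : Commute f u) :
    Commute (expSeries f) u :=
  expSeries_intertwine hf hf h

theorem expSeries_zero : expSeries (0 : R⟦X⟧) = 1 := by
  ext d
  rw [coeff_expSeries (map_zero _) (Nat.lt_succ_self d), expTrunc, Finset.sum_range_succ']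
  simp

theorem expSeries_map (φ : R →ₐ[ℂ] R') (f : R⟦X⟧) :
    expSeries (map (φ : R →+* R') f) = map (φ : R →+* R') (expSeries f) := by
  ext d
  simp only [expSeries, coeff_mk, coeff_map, map_sum, ← map_pow]
  exact Finset.sum_congr rfl fun k _ => (map_smul φ _ _).symm

theorem expSeries_add {f g : R⟦X⟧} (hf : constantCoeff f = 0) (hg : constantCoeff g = 0)
    (h : Commute f g) : expSeries (f + g) = expSeries f * expSeries g := by
  ext d
  set a : ℕ × ℕ → R := fun p =>
    coeff d (((p.1.factorial : ℂ)⁻¹ * (p.2.factorial : ℂ)⁻¹) • (f ^ p.1 * g ^ p.2)) with ha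
  have hvan : ∀ p : ℕ × ℕ, d < p.1 + p.2 → a p = 0 := by
    intro p hp
    have : (d : ℕ∞) < (f ^ p.1 * g ^ p.2).order := by
      refine lt_of_lt_of_le (b := ((p.1 + p.2 : ℕ) : ℕ∞)) (by exact_mod_cast hp) ?_
      refine le_trans ?_ (le_order_mul _ _)
      push_cast
      exact add_le_add (le_order_pow_of_constantCoeff_eq_zero _ hf)
        (le_order_pow_of_constantCoeff_eq_zero _ hg)
    rw [ha]
    simp only [coeff_smul, coeff_of_lt_order _ this, smul_zero]
  have hR : coeff d (expSeries f * expSeries g) =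
      ∑ p ∈ Finset.range (d + 1) ×ˢ Finset.range (d + 1), a p := by
    rw [coeff_mul_congr (x' := expTrunc (d + 1) f) (y' := expTrunc (d + 1) g)
      (fun e he => coeff_expSeries hf (by omega)) (fun e he => coeff_expSeries hg (by omega)),
      expTrunc, expTrunc, Finset.sum_mul_sum, ← Finset.sum_product', map_sum]
    refine Finset.sum_congr rfl fun p _ => ?_
    rw [smul_mul_smul_comm]
  have hL : coeff d (expSeries (f + g)) =
      ∑ k ∈ Finset.range (d + 1), ∑ p ∈ Finset.HasAntidiagonal.antidiagonal k, a p := by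
    rw [coeff_expSeries (by rw [map_add, hf, hg, add_zero]) (Nat.lt_succ_self d), expTrunc, map_sum]
    refine Finset.sum_congr rfl fun k _ => ?_
    rw [h.add_pow', Finset.smul_sum, map_sum]
    refine Finset.sum_congr rfl fun p hp => ?_
    obtain rfl := Finset.HasAntidiagonal.mem_antidiagonal.1 hp
    rw [ha, ← Nat.cast_smul_eq_nsmul ℂ, smul_smul]
    congr 2
    have h1 : ((p.1 + p.2).factorial : ℂ) ≠ 0 := by exact_mod_cast Nat.factorial_ne_zero _
    have h2 : (p.1.factorial : ℂ) ≠ 0 := by exact_mod_cast Nat.factorial_ne_zero _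
    have h3 : (p.2.factorial : ℂ) ≠ 0 := by exact_mod_cast Nat.factorial_ne_zero _
    have h4 : ((p.1 + p.2).choose p.1 : ℂ) * p.1.factorial * p.2.factorial =
        (p.1 + p.2).factorial := by
      rw [Nat.choose_symm_add]
      exact_mod_cast Nat.add_choose_mul_factorial_mul_factorial p.1 p.2
    field_simp
    rw [← h4]
  -- The terms of the right-hand side with `p.1 + p.2 > d` vanish.
  rw [hL, hR, Finset.sum_sigma']
  refine Finset.sum_of_injOn (fun x : (_ : ℕ) × (ℕ × ℕ) => x.2) ?_ ?_ ?_ ?_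
  · rintro ⟨k, p⟩ hx ⟨k', p'⟩ hx' rfl
    simp only [Finset.coe_sigma, Set.mem_sigma_iff, Finset.mem_coe,
      Finset.HasAntidiagonal.mem_antidiagonal] at hx hx'
    obtain rfl : k = k' := hx.2.symm.trans hx'.2
    rfl
  · rintro ⟨k, p⟩ hx
    simp only [Finset.coe_sigma, Set.mem_sigma_iff, Finset.mem_coe, Finset.mem_range,
      Finset.HasAntidiagonal.mem_antidiagonal] at hx
    simp only [Finset.coe_product, Set.mem_prod, Finset.mem_coe, Finset.mem_range]
    omega
  · intro p _ hp
    refine hvan p (not_le.1 fun hle => hp ⟨⟨p.1 + p.2, p⟩, ?_, rfl⟩)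
    simp only [Finset.coe_sigma, Set.mem_sigma_iff, Finset.mem_coe, Finset.mem_range,
      Finset.HasAntidiagonal.mem_antidiagonal]
    exact ⟨by omega, trivial⟩
  · intros; rfl

/-- Conjugation by `exp g` shifts `f` by the commutator `z = [f, g]`. -/
theorem mul_expSeries_of_commutator {f g z : R⟦X⟧} (hg : constantCoeff g = 0)
    (hz : f * g = g * f + z) (hzg : Commute z g) :
    f * expSeries g = expSeries g * (f + z) := by
  have hpow : ∀ k : ℕ, f * g ^ (k + 1) = g ^ (k + 1) * f + ((k + 1 : ℕ) : ℂ) • (z * g ^ k) := by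
    intro k
    induction k with
    | zero => simp [hz]
    | succ k ih =>
      have hcomm : g ^ (k + 1) * z = z * g ^ (k + 1) := (hzg.pow_right (k + 1)).symm.eq
      rw [pow_succ g (k + 1), ← mul_assoc, ih, add_mul, mul_assoc _ f g, hz, mul_add, hcomm,
        smul_mul_assoc, mul_assoc z, ← pow_succ, ← mul_assoc, add_assoc, Nat.cast_succ (k + 1),
        add_smul, one_smul, add_comm (z * _)]
  rw [mul_add, ← (commute_expSeries hg hzg.symm).eq.symm]
  ext d
  rw [map_add, coeff_mul_congr (x := f) (x' := f) (y' := expTrunc (d + 2) g) (fun _ _ => rfl)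
      (fun e he => coeff_expSeries hg (by omega)),
    coeff_mul_congr (y := f) (y' := f) (x' := expTrunc (d + 2) g)
      (fun e he => coeff_expSeries hg (by omega)) (fun _ _ => rfl),
    coeff_mul_congr (x := z) (x' := z) (y' := expTrunc (d + 1) g) (fun _ _ => rfl)
      (fun e he => coeff_expSeries hg (by omega)), ← map_add]
  congr 1
  rw [expTrunc, expTrunc, Finset.mul_sum, Finset.sum_mul, Finset.mul_sum,
    Finset.sum_range_succ' _ (d + 1), Finset.sum_range_succ' _ (d + 1), add_right_comm,
    ← Finset.sum_add_distrib]
  congr 1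
  · refine Finset.sum_congr rfl fun k _ => ?_
    rw [mul_smul_comm, hpow, smul_mul_assoc, mul_smul_comm, smul_add, smul_smul]
    congr 2
    rw [Nat.factorial_succ]
    have h2 : (k.factorial : ℂ) ≠ 0 := by exact_mod_cast Nat.factorial_ne_zero _
    have h3 : ((k : ℂ) + 1) ≠ 0 := by exact_mod_cast Nat.succ_ne_zero k
    push_cast
    field_simp
  · simp

/-- The commutation formula `e^f e^g = e^z e^g e^f` for a central commutator `z = [f, g]`. -/
theorem expSeries_mul_expSeries_of_commutator {f g z : R⟦X⟧} (hf : constantCoeff f = 0)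
    (hg : constantCoeff g = 0) (hz0 : constantCoeff z = 0) (hz : f * g = g * f + z)
    (hzf : Commute z f) (hzg : Commute z g) :
    expSeries f * expSeries g = expSeries z * (expSeries g * expSeries f) := by
  rw [expSeries_intertwine hf (by rw [map_add, hf, hz0, add_zero])
      (mul_expSeries_of_commutator hg hz hzg), add_comm f z, expSeries_add hz0 hf hzf,
    ← mul_assoc, ← mul_assoc]
  congr 1
  exact (commute_expSeries hg (commute_expSeries hz0 hzg).symm).eq

theorem coeff_expSeries_monomial {m : ℕ} (hm : 0 < m) (x : R) :
    coeff m (expSeries (monomial m x)) = x := by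
  have hpow : ∀ k : ℕ, (monomial m x) ^ k = monomial (k * m) (x ^ k) := by
    intro k
    induction k with
    | zero => simp
    | succ k ih => rw [pow_succ, ih, monomial_mul_monomial, pow_succ, Nat.succ_mul]
  rw [expSeries, coeff_mk, Finset.sum_eq_single 1]
  · simp
  · intro k _ hk
    rw [hpow, coeff_monomial, if_neg, smul_zero]
    intro h
    exact hk (Nat.eq_of_mul_eq_mul_right hm (by omega))
  · simp; omega

end Exp

/-! ### Uniform description of the Heisenberg relations -/

/-- The type of the current a generator belongs to: `Sum.inl i` stands for `y_i` and `Sum.inr i`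
for `a_i`. -/
abbrev Kind (n : ℕ) : Type := Fin n ⊕ Fin n

/-- The generator `y_i[m]` or `a_i[m]`. -/
def heisGen {n : ℕ} : Kind n → {m : ℤ // m ≠ 0} → HeisGen n
  | Sum.inl i, m => HeisGen.y i m
  | Sum.inr i, m => HeisGen.a i m

section Pairing

open LaurentPolynomial

/-- The Laurent polynomial `F` such that `[x[m], x'[-m]] = F(q ^ m) c_{|m|}` for the currents
`x, x'` of the given kinds. -/
noncomputable def pairing {n : ℕ} (C : Matrix (Fin n) (Fin n) ℤ) (r : Fin n → ℕ) :
    Kind n → Kind n → ℤ[T;T⁻¹]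
  | Sum.inl _, Sum.inl _ => 0
  | Sum.inl i, Sum.inr j => if i = j then T (r i : ℤ) - T (-(r i : ℤ)) else 0
  | Sum.inr i, Sum.inl j => if i = j then T (r i : ℤ) - T (-(r i : ℤ)) else 0
  | Sum.inr i, Sum.inr j => (T 1 - T (-1)) * symZ C r i j

/-- Evaluation of integral Laurent polynomials, as a ring homomorphism. -/
noncomputable def evalHom (x : ℂˣ) : ℤ[T;T⁻¹] →+* ℂ :=
  LaurentPolynomial.eval₂ (Int.castRingHom ℂ) x

theorem evalHom_T (x : ℂˣ) (k : ℤ) : evalHom x (T k) = ((x ^ k : ℂˣ) : ℂ) :=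
  LaurentPolynomial.eval₂_T _ _ _

theorem evalHom_invert (x : ℂˣ) (P : ℤ[T;T⁻¹]) : evalHom x (invert P) = evalHom x⁻¹ P := by
  induction P using LaurentPolynomial.induction_on' with
  | add p q hp hq => rw [map_add, map_add, map_add, hp, hq]
  | C_mul_T k a =>
    rw [map_mul, map_mul, map_mul, invert_T, invert_C, evalHom_T, evalHom_T, inv_zpow']
    simp

theorem invert_qInt (l : ℤ) : invert (qInt l) = qInt l := by
  unfold qInt
  rw [map_zsmul, map_sum]
  congr 1
  rw [← Finset.sum_range_reflect]
  refine Finset.sum_congr rfl fun k hk => ?_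
  have := Finset.mem_range.1 hk
  rw [invert_T]
  congr 1
  omega

theorem symZ_apply {n : ℕ} (C : Matrix (Fin n) (Fin n) ℤ) (r : Fin n → ℕ) (i j : Fin n) :
    symZ C r i j = qInt (r i) * cartanZ C r i j := by
  rw [symZ, Matrix.diagonal_mul]

theorem invert_symZ {n : ℕ} (C : Matrix (Fin n) (Fin n) ℤ) (r : Fin n → ℕ) (i j : Fin n) :
    invert (symZ C r i j) = symZ C r i j := by
  rw [symZ_apply, map_mul, invert_qInt, cartanZ, Matrix.of_apply]
  split_ifs
  · rw [map_add, invert_T, invert_T, neg_neg, add_comm (T _)]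
  · rw [invert_qInt]

/-- The commutator is antisymmetric because `B(z)` is symmetric and invariant under
`z ↦ z⁻¹`. -/
theorem invert_pairing {n : ℕ} {C : Matrix (Fin n) (Fin n) ℤ} {r : Fin n → ℕ}
    (hB : (symZ C r).IsSymm) (b b' : Kind n) :
    invert (pairing C r b' b) = -pairing C r b b' := by
  have key : ∀ i j : Fin n, invert (if i = j then T (r i : ℤ) - T (-(r i : ℤ)) else 0) =
      -(if j = i then T (r j : ℤ) - T (-(r j : ℤ)) else (0 : ℤ[T;T⁻¹])) := by
    intro i j
    by_cases h : i = j
    · subst h; simp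
    · rw [if_neg h, if_neg (Ne.symm h), map_zero, neg_zero]
  rcases b with i | i <;> rcases b' with j | j <;> simp only [pairing]
  · simp
  · exact key j i
  · exact key j i
  · rw [map_mul, invert_symZ, map_sub, invert_T, invert_T, hB.apply i j, neg_neg]
    ring

theorem evalAt_eq (x : ℂˣ) (P : ℤ[T;T⁻¹]) : evalAt x P = evalHom x P := rfl

theorem evalHom_pairing_neg {n : ℕ} {C : Matrix (Fin n) (Fin n) ℤ} {r : Fin n → ℕ}
    (hB : (symZ C r).IsSymm) (q : ℂˣ) (m : ℤ) (b b' : Kind n) :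
    evalHom (q ^ (-m)) (pairing C r b' b) = -evalHom (q ^ m) (pairing C r b b') := by
  rw [zpow_neg, ← evalHom_invert, invert_pairing hB, map_neg]

end Pairing

section Heis

variable {n : ℕ} (C : Matrix (Fin n) (Fin n) ℤ) (r : Fin n → ℕ) (q : ℂˣ)

/-- `y_i[m]` or `a_i[m]` in the Heisenberg algebra. -/
noncomputable def mode (b : Kind n) (m : {m : ℤ // m ≠ 0}) : Heis C r q :=
  Heis.of C r q (heisGen b m)

theorem Heis.commute_c (p : ℕ+) (x : Heis C r q) : Commute (Heis.of C r q (HeisGen.c p)) x := by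
  obtain ⟨x, rfl⟩ := RingQuot.mkAlgHom_surjective ℂ (HeisRel C r q) x
  induction x using FreeAlgebra.induction with
  | grade0 a => rw [AlgHom.commutes]; exact (Algebra.commutes _ _).symm
  | grade1 g =>
    have := RingQuot.mkAlgHom_rel ℂ (HeisRel.central (C := C) (r := r) (q := q) p g)
    rw [map_mul, map_mul] at this
    exact this
  | mul x y hx hy => rw [map_mul]; exact hx.mul_right hy
  | add x y hx hy => rw [map_add]; exact hx.add_right hy

theorem mode_commutator (b b' : Kind n) (m p : {m : ℤ // m ≠ 0}) :
    mode C r q b m * mode C r q b' p - mode C r q b' p * mode C r q b m =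
      if m.1 = -p.1 then
        evalHom (q ^ m.1) (pairing C r b b') • Heis.of C r q (HeisGen.cAbs m)
      else 0 := by
  have key : ∀ (i j : Fin n) (m p : {m : ℤ // m ≠ 0}),
      mode C r q (Sum.inr i) m * mode C r q (Sum.inl j) p -
        mode C r q (Sum.inl j) p * mode C r q (Sum.inr i) m =
      if m.1 = -p.1 then
        evalHom (q ^ m.1) (pairing C r (Sum.inr i) (Sum.inl j)) • Heis.of C r q (HeisGen.cAbs m)
      else 0 := by
    intro i j m p
    have h := RingQuot.mkAlgHom_rel ℂ (HeisRel.ay (C := C) (r := r) (q := q) i j m p)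
    rw [Ring.lie_def, map_sub, map_mul, map_mul] at h
    refine h.trans ?_
    by_cases h1 : m.1 = -p.1
    · by_cases h2 : i = j
      · rw [if_pos ⟨h1, h2⟩, if_pos h1, map_smul, pairing, if_pos h2, map_sub, evalHom_T, evalHom_T,
          ← zpow_mul, ← zpow_mul, mul_neg, neg_mul, mul_comm (r i : ℤ)]
        rfl
      · rw [if_neg (fun h => h2 h.2), if_pos h1, pairing, if_neg h2, map_zero, map_zero, zero_smul]
    · rw [if_neg (fun h => h1 h.1), if_neg h1, map_zero]
  rcases b with i | i <;> rcases b' with j | j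
  · have h := RingQuot.mkAlgHom_rel ℂ (HeisRel.yy (C := C) (r := r) (q := q) i j m p)
    rw [Ring.lie_def, map_sub, map_mul, map_mul, map_zero] at h
    refine h.trans ?_
    simp [pairing]
  · rw [← neg_sub, key j i p m]
    by_cases h1 : m.1 = -p.1
    · have h2 : p.1 = -m.1 := by omega
      have h3 : HeisGen.cAbs (n := n) p = HeisGen.cAbs m := by
        unfold HeisGen.cAbs
        congr 2
        omega
      rw [if_pos h1, if_pos h2, h2, h3]
      refine (neg_smul (R := ℂ) (M := Heis C r q) _ _).symm.trans ?_
      congr 1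
      simp only [pairing]
      by_cases h : i = j
      · subst h
        simp only [if_true, map_sub, evalHom_T, ← zpow_mul]
        rw [neg_sub, neg_mul_neg, mul_neg, neg_mul]
      · rw [if_neg h, if_neg (Ne.symm h), map_zero, map_zero, neg_zero]
    · rw [if_neg h1, if_neg (by omega), neg_zero]
  · exact key i j m p
  · have h := RingQuot.mkAlgHom_rel ℂ (HeisRel.aa (C := C) (r := r) (q := q) i j m p)
    rw [Ring.lie_def, map_sub, map_mul, map_mul] at h
    refine h.trans ?_
    by_cases h1 : m.1 = -p.1
    · rw [if_pos h1, if_pos h1, map_smul, pairing, map_mul, map_sub, evalHom_T, evalHom_T,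
        zpow_one, zpow_neg_one, zpow_neg, evalAt_eq]
      rfl
    · rw [if_neg h1, if_neg h1, map_zero]

variable {C r q}

/-- The universal property of the Heisenberg algebra. -/
theorem Heis.exists_lift {A : Type*} [Ring A] [Algebra ℂ A] (f : HeisGen n → A)
    (hc : ∀ p g, Commute (f (HeisGen.c p)) (f g))
    (hf : ∀ b b' m p, f (heisGen b m) * f (heisGen b' p) - f (heisGen b' p) * f (heisGen b m) =
      if m.1 = -p.1 then evalHom (q ^ m.1) (pairing C r b b') • f (HeisGen.cAbs m) else 0) :
    ∃ φ : Heis C r q →ₐ[ℂ] A, ∀ g, φ (Heis.of C r q g) = f g := by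
  refine ⟨RingQuot.liftAlgHom ℂ ⟨FreeAlgebra.lift ℂ f, ?_⟩, fun g => ?_⟩
  · intro x y h
    induction h with
    | central p g => simpa [HeisGen.ι] using (hc p g).eq
    | aa i j m p =>
      rw [Ring.lie_def, map_sub, map_mul, map_mul]
      simp only [HeisGen.ι, FreeAlgebra.lift_ι_apply]
      refine (hf (Sum.inr i) (Sum.inr j) m p).trans ?_
      by_cases h1 : m.1 = -p.1
      · rw [if_pos h1, if_pos h1, map_smul, pairing, map_mul, map_sub, evalHom_T, evalHom_T,
          zpow_one, zpow_neg_one, zpow_neg, evalAt_eq, FreeAlgebra.lift_ι_apply]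
      · rw [if_neg h1, if_neg h1, map_zero]
    | ay i j m p =>
      rw [Ring.lie_def, map_sub, map_mul, map_mul]
      simp only [HeisGen.ι, FreeAlgebra.lift_ι_apply]
      refine (hf (Sum.inr i) (Sum.inl j) m p).trans ?_
      by_cases h1 : m.1 = -p.1
      · by_cases h2 : i = j
        · rw [if_pos h1, if_pos ⟨h1, h2⟩, map_smul, pairing, if_pos h2, map_sub, evalHom_T,
            evalHom_T, ← zpow_mul, ← zpow_mul, mul_neg, neg_mul, mul_comm (r i : ℤ),
            FreeAlgebra.lift_ι_apply]
        · rw [if_pos h1, if_neg (fun h => h2 h.2), pairing, if_neg h2, map_zero, map_zero,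
            zero_smul]
      · rw [if_neg h1, if_neg (fun h => h1 h.1), map_zero]
    | yy i j m p =>
      rw [Ring.lie_def, map_sub, map_mul, map_mul, map_zero]
      simp only [HeisGen.ι, FreeAlgebra.lift_ι_apply]
      refine (hf (Sum.inl i) (Sum.inl j) m p).trans ?_
      simp [pairing]
  · rw [Heis.of, RingQuot.liftAlgHom_mkAlgHom_apply, HeisGen.ι, FreeAlgebra.lift_ι_apply]

/-- Adding a scalar to each mode is an endomorphism, as commutators are central. -/
theorem Heis.exists_translation (θ : Kind n → ℤ → ℂ) :
    ∃ τ : Heis C r q →ₐ[ℂ] Heis C r q,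
      (∀ b m, τ (mode C r q b m) = mode C r q b m + algebraMap ℂ _ (θ b m.1)) ∧
      ∀ p, τ (Heis.of C r q (HeisGen.c p)) = Heis.of C r q (HeisGen.c p) := by
  let f : HeisGen n → Heis C r q
    | HeisGen.a i m => mode C r q (Sum.inr i) m + algebraMap ℂ _ (θ (Sum.inr i) m.1)
    | HeisGen.y i m => mode C r q (Sum.inl i) m + algebraMap ℂ _ (θ (Sum.inl i) m.1)
    | HeisGen.c p => Heis.of C r q (HeisGen.c p)
  have hfg : ∀ b m, f (heisGen b m) = mode C r q b m + algebraMap ℂ _ (θ b m.1) := by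
    rintro (i | i) m <;> rfl
  obtain ⟨τ, hτ⟩ := Heis.exists_lift (C := C) (r := r) (q := q) f
    (fun p g => Heis.commute_c C r q p _) (by
      intro b b' m p
      rw [hfg, hfg]
      refine Eq.trans ?_ (mode_commutator C r q b b' m p)
      have h1 := Algebra.commutes (θ b m.1) (mode C r q b' p)
      have h2 := Algebra.commutes (θ b' p.1) (mode C r q b m)
      have h3 := Algebra.commutes (θ b m.1) (algebraMap ℂ (Heis C r q) (θ b' p.1))
      rw [add_mul, mul_add, mul_add, add_mul, mul_add, mul_add, h1, h2, h3]
      abel)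
  exact ⟨τ, fun b m => (hτ _).trans (hfg b m), fun p => hτ _⟩

/-- The Fock space: polynomials in the modes. -/
abbrev Fock (n : ℕ) : Type := MvPolynomial (Kind n × {m : ℤ // m ≠ 0}) ℂ

/-- The Heisenberg algebra acts on the Fock space with arbitrary central charges `γ_p`: a mode acts
by multiplication by its variable plus half the derivation given by the commutator. -/
theorem Heis.exists_fock (hB : (symZ C r).IsSymm) (γ : ℕ → ℂ) :
    ∃ ρ : Heis C r q →ₐ[ℂ] Module.End ℂ (Fock n),
      ∀ p : ℕ+, ρ (Heis.of C r q (HeisGen.c p)) = algebraMap ℂ _ (γ p) := by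
  let ω : Kind n × {m : ℤ // m ≠ 0} → Kind n × {m : ℤ // m ≠ 0} → ℂ := fun g g' =>
    if g.2.1 = -g'.2.1 then evalHom (q ^ g.2.1) (pairing C r g.1 g'.1) * γ g.2.1.natAbs else 0
  have hω : ∀ g g', ω g g' = -ω g' g := by
    rintro ⟨b, m⟩ ⟨b', p⟩
    simp only [ω]
    by_cases h : m.1 = -p.1
    · have h2 : p.1 = -m.1 := by omega
      rw [if_pos h, if_pos h2, h2, evalHom_pairing_neg hB, Int.natAbs_neg]
      ring
    · rw [if_neg h, if_neg (by omega), neg_zero]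
  let D : Kind n × {m : ℤ // m ≠ 0} → Derivation ℂ (Fock n) (Fock n) := fun g =>
    MvPolynomial.mkDerivation ℂ fun g' => MvPolynomial.C (ω g g' / 2)
  have hDX : ∀ g g', D g (MvPolynomial.X g') = MvPolynomial.C (ω g g' / 2) := fun g g' =>
    MvPolynomial.mkDerivation_X _ _ _
  have hDD : ∀ g g', ⁅D g, D g'⁆ = 0 := by
    intro g g'
    refine MvPolynomial.derivation_ext fun i => ?_
    rw [Derivation.commutator_apply, hDX, hDX]
    simp [MvPolynomial.derivation_C]
  let F : Kind n × {m : ℤ // m ≠ 0} → Module.End ℂ (Fock n) := fun g =>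
    LinearMap.mulLeft ℂ (MvPolynomial.X g) + (D g : Fock n →ₗ[ℂ] Fock n)
  have hF : ∀ g g', F g * F g' - F g' * F g = algebraMap ℂ _ (ω g g') := by
    intro g g'
    refine LinearMap.ext fun v => ?_
    have hv : D g (D g' v) = D g' (D g v) := by
      have := congrArg (fun E : Derivation ℂ (Fock n) (Fock n) => E v) (hDD g g')
      simp only [Derivation.commutator_apply] at this
      exact sub_eq_zero.1 this
    have hsum : MvPolynomial.C (ω g g' / 2) - MvPolynomial.C (ω g' g / 2) =
        (MvPolynomial.C (ω g g') : Fock n) := by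
      rw [← map_sub, hω g' g]
      congr 1
      ring
    simp only [F, LinearMap.sub_apply, Module.End.mul_apply, LinearMap.add_apply,
      LinearMap.mulLeft_apply, Derivation.coeFn_coe, map_add, Derivation.leibniz, hDX, hv,
      smul_eq_mul, Module.algebraMap_end_apply]
    rw [MvPolynomial.smul_eq_C_mul, ← hsum]
    ring
  let f : HeisGen n → Module.End ℂ (Fock n)
    | HeisGen.a i m => F (Sum.inr i, m)
    | HeisGen.y i m => F (Sum.inl i, m)
    | HeisGen.c p => algebraMap ℂ _ (γ p)
  have hfg : ∀ b m, f (heisGen b m) = F (b, m) := by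
    rintro (i | i) m <;> rfl
  obtain ⟨ρ, hρ⟩ := Heis.exists_lift (C := C) (r := r) (q := q) f
    (fun p g => Algebra.commutes _ _) (by
      intro b b' m p
      rw [hfg, hfg, hF]
      simp only [ω, f, HeisGen.cAbs]
      by_cases h : m.1 = -p.1
      · rw [if_pos h, if_pos h, map_mul, Algebra.smul_def]
        rfl
      · rw [if_neg h, if_neg h, map_zero])
  exact ⟨ρ, fun p => hρ _⟩

end Heis

/-! ### Currents and their commutation -/

section Series

open PowerSeries

/-- Series whose coefficients commute except in equal degrees; `z i` contributes in degree `2 i`. -/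
theorem mk_mul_mk_of_commutator {R : Type*} [Ring R] {x x' z : ℕ → R}
    (h : ∀ i j, x i * x' j - x' j * x i = if i = j then z i else 0) :
    mk x * mk x' = mk x' * mk x + mk (fun d => if Even d then z (d / 2) else 0) := by
  rw [← sub_eq_iff_eq_add']
  ext d
  rw [map_sub, coeff_mul, coeff_mul, ← Finset.Nat.sum_antidiagonal_swap, ← Finset.sum_sub_distrib,
    coeff_mk]
  simp only [Prod.fst_swap, Prod.snd_swap, coeff_mk]
  have h' : ∀ p : ℕ × ℕ, x p.2 * x' p.1 - x' p.1 * x p.2 = if p.2 = p.1 then z p.2 else 0 :=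
    fun p => h p.2 p.1
  simp only [h']
  split_ifs with hd
  · obtain ⟨e, rfl⟩ := hd
    rw [Finset.sum_eq_single (e, e)]
    · rw [if_pos rfl]
      congr 1
      omega
    · rintro ⟨a, b⟩ hp hne
      have := Finset.HasAntidiagonal.mem_antidiagonal.1 hp
      refine if_neg fun hab => hne ?_
      simp only at hab this
      rw [Prod.mk.injEq]
      omega
    · intro hp
      exact absurd (Finset.HasAntidiagonal.mem_antidiagonal (n := e + e) (a := (e, e)).2 rfl) hp
  · refine Finset.sum_eq_zero fun p hp => if_neg fun hab => hd ?_
    have := Finset.HasAntidiagonal.mem_antidiagonal.1 hp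
    exact ⟨p.1, by omega⟩

variable {n : ℕ} (C : Matrix (Fin n) (Fin n) ℤ) (r : Fin n → ℕ) (q : ℂˣ)

/-- The central series `∑_{m > 0} h ^ (2 m) w_m c_m`. -/
noncomputable def cSeries (w : ℕ → ℂ) : (Heis C r q)⟦X⟧ :=
  PowerSeries.mk fun d =>
    if hd : 0 < d / 2 ∧ Even d then w (d / 2) • Heis.of C r q (HeisGen.c ⟨d / 2, hd.1⟩) else 0

theorem constantCoeff_cSeries (w : ℕ → ℂ) : constantCoeff (cSeries C r q w) = 0 := by
  simp [cSeries]

theorem constantCoeff_posSum (x : {m : ℤ // m ≠ 0} → Heis C r q) (l : ℤ) :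
    constantCoeff (posSum C r q x l) = 0 := by
  simp [posSum]

theorem constantCoeff_negSum (x : {m : ℤ // m ≠ 0} → Heis C r q) (l : ℤ) :
    constantCoeff (negSum C r q x l) = 0 := by
  simp [negSum]

theorem commute_cSeries (w : ℕ → ℂ) (f : (Heis C r q)⟦X⟧) : Commute (cSeries C r q w) f := by
  have hc : ∀ (e : ℕ) (x : Heis C r q), Commute (coeff e (cSeries C r q w)) x := by
    intro e x
    rw [cSeries, coeff_mk]
    split_ifs
    · exact Commute.smul_left (Heis.commute_c C r q _ _) _
    · exact Commute.zero_left _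
  ext d
  rw [coeff_mul, coeff_mul, ← Finset.Nat.sum_antidiagonal_swap]
  exact Finset.sum_congr rfl fun p _ => hc _ _

theorem cSeries_add (w w' : ℕ → ℂ) :
    cSeries C r q (w + w') = cSeries C r q w + cSeries C r q w' := by
  ext d
  simp only [cSeries, map_add, coeff_mk, Pi.add_apply]
  split_ifs
  · exact add_smul _ _ _
  · rw [add_zero]

/-- The central group-like series `exp (∑_{m > 0} h ^ (2 m) w_m c_m)`. -/
noncomputable def expC : Multiplicative (ℕ → ℂ) →* (Heis C r q)⟦X⟧ where
  toFun w := expSeries (cSeries C r q w.toAdd)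
  map_one' := by
    have : cSeries C r q 0 = 0 := by
      ext d
      simp only [cSeries, coeff_mk, Pi.zero_apply, map_zero]
      split_ifs
      · exact zero_smul _ _
      · rfl
    rw [toAdd_one, this, expSeries_zero]
  map_mul' w w' := by
    rw [toAdd_mul, cSeries_add, expSeries_add (constantCoeff_cSeries C r q _)
      (constantCoeff_cSeries C r q _) (commute_cSeries C r q _ _)]

theorem expC_apply (w : ℕ → ℂ) :
    expC C r q (Multiplicative.ofAdd w) = expSeries (cSeries C r q w) := rfl

theorem commute_expC (w : Multiplicative (ℕ → ℂ)) (f : (Heis C r q)⟦X⟧) :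
    Commute (expC C r q w) f :=
  commute_expSeries (constantCoeff_cSeries C r q _) (commute_cSeries C r q _ _)

/-- `Ỹ_{i,l}` or `Ã_{i,l}`. -/
noncomputable def current : Kind n → ℤ → (Heis C r q)⟦X⟧ˣ
  | Sum.inl i, l => Ytilde C r q i l
  | Sum.inr i, l => Atilde C r q i l

theorem val_current (b : Kind n) (l : ℤ) : (current C r q b l : (Heis C r q)⟦X⟧) =
    expSeries (posSum C r q (mode C r q b) l) * expSeries (negSum C r q (mode C r q b) l) := by
  rcases b with i | i <;> rfl

theorem smul_mode_commutator (a a' : ℂ) (b b' : Kind n) (m p : {m : ℤ // m ≠ 0}) :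
    (a • mode C r q b m) * (a' • mode C r q b' p) - (a' • mode C r q b' p) * (a • mode C r q b m) =
      (a * a') • if m.1 = -p.1 then
        evalHom (q ^ m.1) (pairing C r b b') • Heis.of C r q (HeisGen.cAbs m)
      else 0 := by
  rw [← mode_commutator, Algebra.smul_def, Algebra.smul_def, Algebra.smul_def, map_mul]
  have h1 := fun x : Heis C r q => Algebra.commutes a x
  have h2 := fun x : Heis C r q => Algebra.commutes a' x
  generalize algebraMap ℂ (Heis C r q) a = α at *
  generalize algebraMap ℂ (Heis C r q) a' = α' at *
  have key : ∀ x y : Heis C r q, α * x * (α' * y) = α * α' * (x * y) := fun x y => by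
    rw [mul_assoc α x, ← mul_assoc x, ← h2, mul_assoc α', mul_assoc]
  have key' : ∀ x y : Heis C r q, α' * x * (α * y) = α * α' * (x * y) := fun x y => by
    rw [mul_assoc α' x, ← mul_assoc x, ← h1, mul_assoc α x, ← mul_assoc, h2]
  rw [key, key', mul_sub]

theorem commute_posSum (b b' : Kind n) (l k : ℤ) :
    Commute (posSum C r q (mode C r q b) l) (posSum C r q (mode C r q b') k) := by
  have := mk_mul_mk_of_commutator (z := 0)
    (x := fun m : ℕ => if hm : m = 0 then 0 else
      ((q ^ (l * (m : ℤ)) : ℂˣ) : ℂ) • mode C r q b ⟨(m : ℤ), by exact_mod_cast hm⟩)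
    (x' := fun m : ℕ => if hm : m = 0 then 0 else
      ((q ^ (k * (m : ℤ)) : ℂˣ) : ℂ) • mode C r q b' ⟨(m : ℤ), by exact_mod_cast hm⟩) (by
    intro i j
    rw [Pi.zero_apply, ite_self]
    by_cases hi : i = 0
    · rw [dif_pos hi, zero_mul, mul_zero, sub_zero]
    by_cases hj : j = 0
    · rw [dif_pos hj, zero_mul, mul_zero, sub_zero]
    rw [dif_neg hi, dif_neg hj]
    rw [smul_mode_commutator, if_neg (by simp only; omega), smul_zero])
  refine this.trans ?_
  simp only [Pi.zero_apply, ite_self]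
  exact add_zero _

theorem commute_negSum (b b' : Kind n) (l k : ℤ) :
    Commute (negSum C r q (mode C r q b) l) (negSum C r q (mode C r q b') k) := by
  have := mk_mul_mk_of_commutator (z := 0)
    (x := fun m : ℕ => if hm : m = 0 then 0 else
      ((q ^ (-l * (m : ℤ)) : ℂˣ) : ℂ) • mode C r q b ⟨-(m : ℤ), by simpa using hm⟩)
    (x' := fun m : ℕ => if hm : m = 0 then 0 else
      ((q ^ (-k * (m : ℤ)) : ℂˣ) : ℂ) • mode C r q b' ⟨-(m : ℤ), by simpa using hm⟩) (by
    intro i j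
    rw [Pi.zero_apply, ite_self]
    by_cases hi : i = 0
    · rw [dif_pos hi, zero_mul, mul_zero, sub_zero]
    by_cases hj : j = 0
    · rw [dif_pos hj, zero_mul, mul_zero, sub_zero]
    rw [dif_neg hi, dif_neg hj]
    rw [smul_mode_commutator, if_neg (by simp only; omega), smul_zero])
  refine this.trans ?_
  simp only [Pi.zero_apply, ite_self]
  exact add_zero _

open LaurentPolynomial in
theorem posSum_mul_negSum (b b' : Kind n) (l k : ℤ) :
    posSum C r q (mode C r q b) l * negSum C r q (mode C r q b') k =
      negSum C r q (mode C r q b') k * posSum C r q (mode C r q b) l +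
        cSeries C r q (fun m => evalHom (q ^ (m : ℤ)) (T (l - k) * pairing C r b b')) := by
  have := mk_mul_mk_of_commutator
    (z := fun m : ℕ => if hm : 0 < m then evalHom (q ^ (m : ℤ)) (T (l - k) * pairing C r b b') •
      Heis.of C r q (HeisGen.c (⟨m, hm⟩ : ℕ+)) else 0)
    (x := fun m : ℕ => if hm : m = 0 then 0 else
      ((q ^ (l * (m : ℤ)) : ℂˣ) : ℂ) • mode C r q b ⟨(m : ℤ), by exact_mod_cast hm⟩)
    (x' := fun m : ℕ => if hm : m = 0 then 0 else
      ((q ^ (-k * (m : ℤ)) : ℂˣ) : ℂ) • mode C r q b' ⟨-(m : ℤ), by simpa using hm⟩) (by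
    intro i j
    by_cases hi : i = 0
    · subst hi
      simp
    by_cases hj : j = 0
    · subst hj
      simp [hi]
    rw [dif_neg hi, dif_neg hj]
    rw [smul_mode_commutator]
    by_cases hij : i = j
    · subst hij
      rw [if_pos (by simp), if_pos rfl, dif_pos (Nat.pos_of_ne_zero hi), smul_smul, map_mul,
        evalHom_T, ← Units.val_mul, ← zpow_add, ← zpow_mul]
      congr 2
      congr 3
      ring
    · rw [if_neg (by simp only; omega), if_neg hij, smul_zero])
  refine this.trans ?_
  refine congrArg _ ?_
  rw [cSeries]
  congr 1
  funext d
  by_cases h1 : Even d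
  · by_cases h2 : 0 < d / 2
    · rw [if_pos h1, dif_pos h2, dif_pos ⟨h2, h1⟩]
    · rw [if_pos h1, dif_neg h2, dif_neg (fun h => h2 h.1)]
  · rw [if_neg h1, dif_neg (fun h => h1 h.2)]

open LaurentPolynomial in
theorem negSum_mul_posSum {C : Matrix (Fin n) (Fin n) ℤ} {r : Fin n → ℕ}
    (hB : (symZ C r).IsSymm) (b b' : Kind n) (l k : ℤ) :
    negSum C r q (mode C r q b) l * posSum C r q (mode C r q b') k =
      posSum C r q (mode C r q b') k * negSum C r q (mode C r q b) l +
        cSeries C r q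
          (fun m => evalHom (q ^ (m : ℤ)) (invert (T (l - k) * pairing C r b b'))) := by
  have h := posSum_mul_negSum C r q b' b k l
  have hw : (fun m : ℕ => evalHom (q ^ (m : ℤ)) (invert (T (l - k) * pairing C r b b'))) +
      (fun m : ℕ => evalHom (q ^ (m : ℤ)) (T (k - l) * pairing C r b' b)) = 0 := by
    funext m
    rw [Pi.add_apply, map_mul invert, invert_T, invert_pairing hB, neg_sub, mul_neg, map_neg,
      neg_add_cancel, Pi.zero_apply]
  rw [h, add_assoc, add_comm (cSeries C r q _), ← cSeries_add, hw]
  have h0 := cSeries_add C r q 0 0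
  rw [add_zero] at h0
  rw [left_eq_add.1 h0, add_zero]

open LaurentPolynomial in
/-- Two currents commute up to a central series, whose logarithm is the sum of the commutators of
the positive with the negative modes. -/
theorem current_mul_current {C : Matrix (Fin n) (Fin n) ℤ} {r : Fin n → ℕ}
    (hB : (symZ C r).IsSymm) (b b' : Kind n) (l k : ℤ) :
    (current C r q b l * current C r q b' k : (Heis C r q)⟦X⟧) =
      expC C r q (Multiplicative.ofAdd fun m : ℕ => evalHom (q ^ (m : ℤ))
        (T (l - k) * pairing C r b b' + invert (T (l - k) * pairing C r b b'))) *
        (current C r q b' k * current C r q b l) := by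
  have hPN := expSeries_mul_expSeries_of_commutator (constantCoeff_posSum C r q _ l)
    (constantCoeff_negSum C r q _ k) (constantCoeff_cSeries C r q _)
    (posSum_mul_negSum C r q b b' l k) (commute_cSeries C r q _ _) (commute_cSeries C r q _ _)
  have hNP := expSeries_mul_expSeries_of_commutator (constantCoeff_negSum C r q _ l)
    (constantCoeff_posSum C r q _ k) (constantCoeff_cSeries C r q _)
    (negSum_mul_posSum q hB b b' l k) (commute_cSeries C r q _ _) (commute_cSeries C r q _ _)
  have hPP := (commute_expSeries (constantCoeff_posSum C r q _ l)
    (commute_expSeries (constantCoeff_posSum C r q _ k) (commute_posSum C r q b' b k l)).symm).eq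
  have hNN := (commute_expSeries (constantCoeff_negSum C r q _ l)
    (commute_expSeries (constantCoeff_negSum C r q _ k) (commute_negSum C r q b' b k l)).symm).eq
  have hw : (Multiplicative.ofAdd fun m : ℕ => evalHom (q ^ (m : ℤ))
      (T (l - k) * pairing C r b b' + invert (T (l - k) * pairing C r b b'))) =
      (Multiplicative.ofAdd fun m : ℕ => evalHom (q ^ (m : ℤ))
        (invert (T (l - k) * pairing C r b b'))) *
      (Multiplicative.ofAdd fun m : ℕ => evalHom (q ^ (m : ℤ)) (T (l - k) * pairing C r b b')) := by
    rw [← ofAdd_add]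
    congr 1
    funext m
    rw [Pi.add_apply, map_add, add_comm]
  rw [hw, map_mul]
  rw [← expC_apply] at hPN hNP
  have hz1 := fun f => (commute_expC C r q (Multiplicative.ofAdd fun m : ℕ =>
    evalHom (q ^ (m : ℤ)) (T (l - k) * pairing C r b b')) f).eq
  have hz2 := fun f => (commute_expC C r q (Multiplicative.ofAdd fun m : ℕ =>
    evalHom (q ^ (m : ℤ)) (invert (T (l - k) * pairing C r b b'))) f).eq
  simp only [val_current]
  generalize expC C r q (Multiplicative.ofAdd fun m : ℕ =>
    evalHom (q ^ (m : ℤ)) (T (l - k) * pairing C r b b')) = z₁ at *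
  generalize expC C r q (Multiplicative.ofAdd fun m : ℕ =>
    evalHom (q ^ (m : ℤ)) (invert (T (l - k) * pairing C r b b'))) = z₂ at *
  generalize expSeries (posSum C r q (mode C r q b) l) = P at *
  generalize expSeries (negSum C r q (mode C r q b) l) = N at *
  generalize expSeries (posSum C r q (mode C r q b') k) = P' at *
  generalize expSeries (negSum C r q (mode C r q b') k) = N' at *
  -- Move `N` past `P'` and `P` past `N'`, collecting the central factors.
  calc P * N * (P' * N') = P * (N * P') * N' := by simp only [mul_assoc]
    _ = (P * z₂) * P' * (N * N') := by rw [hNP]; simp only [mul_assoc]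
    _ = z₂ * (P * P') * (N' * N) := by rw [← hz2 P, hNN]; simp only [mul_assoc]
    _ = z₂ * P' * (P * N') * N := by rw [hPP]; simp only [mul_assoc]
    _ = z₂ * (P' * z₁) * (N' * P * N) := by rw [hPN]; simp only [mul_assoc]
    _ = z₂ * z₁ * (P' * N' * (P * N)) := by rw [← hz1 P']; simp only [mul_assoc]

end Series

section Central

variable {n : ℕ} (C : Matrix (Fin n) (Fin n) ℤ) (r : Fin n → ℕ) (q : ℂˣ) (s : ℕ)

/-- `m ↦ ∑_l κ_l q ^ (l m)`: the coefficients of the logarithm of `∏_l t_l ^ κ_l`. -/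
noncomputable def powerSums : (ZMod s →₀ ℤ) →+ (ℕ → ℂ) :=
  Finsupp.liftAddHom fun l =>
    zmultiplesHom (ℕ → ℂ) fun m => ((q ^ ((l.cast : ℤ) * (m : ℤ)) : ℂˣ) : ℂ)

theorem powerSums_single (l : ZMod s) (a : ℤ) (m : ℕ) :
    powerSums q s (Finsupp.single l a) m = a * ((q ^ ((l.cast : ℤ) * (m : ℤ)) : ℂˣ) : ℂ) := by
  simp [powerSums]

theorem powerSums_apply (κ : ZMod s →₀ ℤ) (m : ℕ) :
    powerSums q s κ m = ∑ l ∈ κ.support, (κ l : ℂ) * ((q ^ ((l.cast : ℤ) * (m : ℤ)) : ℂˣ) : ℂ) := by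
  rw [powerSums, Finsupp.liftAddHom_apply, Finsupp.sum, Finset.sum_apply]
  simp

/-- `∏_l t_l ^ κ_l`. -/
noncomputable def tMonomial : Multiplicative (ZMod s →₀ ℤ) →* (Heis C r q)⟦X⟧ :=
  (expC C r q).comp (AddMonoidHom.toMultiplicative (powerSums q s))

theorem commute_tMonomial (κ : Multiplicative (ZMod s →₀ ℤ)) (f : (Heis C r q)⟦X⟧) :
    Commute (tMonomial C r q s κ) f :=
  commute_expC C r q _ f

theorem tMonomial_single (l : ZMod s) :
    tMonomial C r q s (Multiplicative.ofAdd (Finsupp.single l 1)) = tSeries C r q l.cast := by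
  have : powerSums q s (Finsupp.single l 1) =
      fun m : ℕ => ((q ^ ((l.cast : ℤ) * (m : ℤ)) : ℂˣ) : ℂ) := by
    funext m
    rw [powerSums_single, Int.cast_one, one_mul]
  change expSeries (cSeries C r q (powerSums q s (Finsupp.single l 1))) = _
  rw [this]
  rfl

theorem tMonomial_single_neg (l : ZMod s) :
    tMonomial C r q s (Multiplicative.ofAdd (Finsupp.single l (-1))) =
      ↑((tSeries C r q l.cast)⁻¹) := by
  rw [← mul_one (↑((tSeries C r q l.cast)⁻¹) : (Heis C r q)⟦X⟧), Units.eq_inv_mul_iff_mul_eq,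
    ← tMonomial_single, ← map_mul, ← ofAdd_add, ← Finsupp.single_add,
    add_neg_cancel, Finsupp.single_zero, ofAdd_zero, map_one]

/-- Reduction of exponents modulo `s`, from Laurent polynomials to `ℤ[ℤ/sℤ]`. -/
noncomputable def reduceExp : ℤ[T;T⁻¹] →+ (ZMod s →₀ ℤ) :=
  (Finsupp.mapDomain.addMonoidHom (Int.cast : ℤ → ZMod s)).comp
    AddMonoidAlgebra.coeffAddEquiv.toAddMonoidHom

theorem reduceExp_T (k : ℤ) : reduceExp s (LaurentPolynomial.T k) = Finsupp.single (k : ZMod s) 1 := by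
  exact Finsupp.mapDomain_single

variable {q s}

theorem powerSums_reduceExp (hs : IsPrimitiveRoot q s) (P : ℤ[T;T⁻¹]) (m : ℕ) :
    powerSums q s (reduceExp s P) m = evalHom (q ^ (m : ℤ)) P := by
  induction P using LaurentPolynomial.induction_on' with
  | add p q hp hq => rw [map_add, map_add, map_add, Pi.add_apply, hp, hq]
  | C_mul_T k a =>
    rw [← LaurentPolynomial.smul_eq_C_mul, map_zsmul, map_zsmul, map_zsmul, Pi.smul_apply,
      reduceExp_T, powerSums_single, evalHom_T, Int.cast_one, one_mul, ← zpow_mul, mul_comm (m : ℤ),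
      zpow_mul_eq_of_cast_eq hs (l := ((k : ZMod s).cast : ℤ)) (l' := k) (by simp)]

open LaurentPolynomial in
/-- The exponents of the `t_l` in the commutation relation of two currents. -/
noncomputable def commExp (C : Matrix (Fin n) (Fin n) ℤ) (r : Fin n → ℕ) (s : ℕ)
    (b b' : Kind n) (l k : ℤ) : ZMod s →₀ ℤ :=
  reduceExp s (T (l - k) * pairing C r b b' + invert (T (l - k) * pairing C r b b'))

theorem current_mul_current_eq_tMonomial {C : Matrix (Fin n) (Fin n) ℤ} {r : Fin n → ℕ}
    (hB : (symZ C r).IsSymm) (hs : IsPrimitiveRoot q s) (b b' : Kind n) (l k : ℤ) :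
    (current C r q b l * current C r q b' k : (Heis C r q)⟦X⟧) =
      tMonomial C r q s (Multiplicative.ofAdd (commExp C r s b b' l k)) *
        (current C r q b' k * current C r q b l) := by
  rw [current_mul_current q hB, tMonomial, MonoidHom.comp_apply]
  have h : powerSums q s (commExp C r s b b' l k) = _ :=
    funext fun m => powerSums_reduceExp hs _ m
  rw [← h]
  rfl

end Central

/-! ### Characters -/

section ScalarSeries

open PowerSeries

/-- `exp (∑_{m > 0} w_m h ^ m)` in `ℂ[[h]]`. -/
noncomputable def expScalar : Multiplicative (ℕ → ℂ) →* ℂ⟦X⟧ where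
  toFun w := expSeries (mk fun m => if m = 0 then 0 else w.toAdd m)
  map_one' := by
    rw [← expSeries_zero]
    congr 1
    ext m
    simp
  map_mul' w w' := by
    rw [← expSeries_add (by simp) (by simp) (Commute.all _ _)]
    congr 1
    ext m
    by_cases hm : m = 0 <;> simp [hm]

theorem expScalar_apply (w : ℕ → ℂ) : expScalar (Multiplicative.ofAdd w) =
    expSeries (mk fun m => if m = 0 then 0 else w m) := rfl

theorem coeff_expScalar_single {m : ℕ} (hm : 0 < m) (x : ℂ) :
    coeff m (expScalar (Multiplicative.ofAdd (Pi.single m x))) = x := by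
  rw [expScalar_apply]
  refine Eq.trans ?_ (coeff_expSeries_monomial hm x)
  congr 2
  ext d
  rw [coeff_mk, coeff_monomial]
  by_cases hd : d = m
  · subst hd
    simp [hm.ne']
  · simp [hd]

variable {A : Type*} [Ring A] [Algebra ℂ A]

theorem commute_map_algebraMap (e : ℂ⟦X⟧) (f : A⟦X⟧) : Commute (map (algebraMap ℂ A) e) f := by
  ext d
  rw [coeff_mul, coeff_mul, ← Finset.Nat.sum_antidiagonal_swap]
  refine Finset.sum_congr rfl fun p _ => ?_
  rw [coeff_map, coeff_map]
  exact Algebra.commutes _ _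

theorem expSeries_map_algebraMap (f : ℂ⟦X⟧) :
    expSeries (map (algebraMap ℂ A) f) = map (algebraMap ℂ A) (expSeries f) :=
  expSeries_map (Algebra.ofId ℂ A) f

/-- Dedekind's independence of characters, with coefficients in `A[[h]]` instead of the domain
`ℂ[[h]]`. -/
theorem eq_zero_of_sum_character_mul_eq_zero {G ι : Type*} [Monoid G] (χ : ι → G →* ℂ⟦X⟧)
    (hχ : Function.Injective χ) (S : Finset ι) (x : ι → A⟦X⟧)
    (h : ∀ g, ∑ i ∈ S, map (algebraMap ℂ A) (χ i g) * x i = 0) : ∀ i ∈ S, x i = 0 := by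
  intro i hi
  ext d
  rw [map_zero, ← Module.forall_dual_apply_eq_zero_iff ℂ]
  intro ℓ
  -- A linear form on `A` reduces the claim to scalar coefficients.
  have hlin := linearIndependent_iff'.1
    ((linearIndependent_monoidHom G ℂ⟦X⟧).comp χ hχ) S (fun i => mk fun d => ℓ (coeff d (x i))) (by
      funext g
      ext d
      have := congrArg ℓ (congrArg (coeff d) (h g))
      rw [map_sum, map_sum, map_zero, map_zero] at this
      rw [Finset.sum_apply, map_sum, Pi.zero_apply, map_zero, ← this]
      refine Finset.sum_congr rfl fun i _ => ?_
      rw [Function.comp_apply, Pi.smul_apply, smul_eq_mul, mul_comm, coeff_mul, coeff_mul, map_sum]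
      refine Finset.sum_congr rfl fun p _ => ?_
      rw [coeff_map, coeff_mk, ← Algebra.smul_def, map_smul, smul_eq_mul]) i hi
  have := congrArg (coeff d) hlin
  rwa [coeff_mk, map_zero] at this

end ScalarSeries

section Translation

open PowerSeries

variable {n : ℕ} {C : Matrix (Fin n) (Fin n) ℤ} {r : Fin n → ℕ} {q : ℂˣ}

/-- Currents are eigenvectors of the translations of the positive modes. -/
theorem exists_translation_current (θ : Kind n → ℕ → ℂ) :
    ∃ τ : Heis C r q →ₐ[ℂ] Heis C r q,
      (∀ b l, map (τ : Heis C r q →+* Heis C r q) (current C r q b l) =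
        map (algebraMap ℂ _) (expScalar (Multiplicative.ofAdd
          fun m : ℕ => ((q ^ (l * (m : ℤ)) : ℂˣ) : ℂ) * θ b m)) *
            (current C r q b l : (Heis C r q)⟦X⟧)) ∧
      ∀ w, map (τ : Heis C r q →+* Heis C r q) (expC C r q w) = expC C r q w := by
  obtain ⟨τ, hτ, hc⟩ := Heis.exists_translation (C := C) (r := r) (q := q)
    fun b m => if 0 < m then θ b m.toNat else 0
  refine ⟨τ, fun b l => ?_, fun w => ?_⟩
  · have hP : map (τ : Heis C r q →+* Heis C r q) (posSum C r q (mode C r q b) l) =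
        map (algebraMap ℂ _) (mk fun m : ℕ => if m = 0 then 0 else
          ((q ^ (l * (m : ℤ)) : ℂˣ) : ℂ) * θ b m) + posSum C r q (mode C r q b) l := by
      ext m
      rw [map_add, coeff_map, coeff_map, posSum, coeff_mk, coeff_mk]
      by_cases hm : m = 0
      · rw [dif_pos hm, if_pos hm, map_zero, map_zero, zero_add]
      · rw [dif_neg hm, if_neg hm]
        refine (map_smul τ _ _).trans ?_
        rw [hτ]
        refine (smul_add _ _ _).trans ?_
        rw [add_comm, if_pos (by simp only; omega), Int.toNat_natCast, map_mul,
          Algebra.smul_def _ (algebraMap _ _ _)]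
    have hN : map (τ : Heis C r q →+* Heis C r q) (negSum C r q (mode C r q b) l) =
        negSum C r q (mode C r q b) l := by
      ext m
      rw [coeff_map, negSum, coeff_mk]
      by_cases hm : m = 0
      · rw [dif_pos hm, map_zero]
      · rw [dif_neg hm]
        refine (map_smul τ _ _).trans ?_
        rw [hτ, if_neg (by simp only; omega), map_zero, add_zero]
    rw [val_current, map_mul, ← expSeries_map, ← expSeries_map, hP, hN, expSeries_add
      (by rw [← coeff_zero_eq_constantCoeff_apply, coeff_map, coeff_mk, if_pos rfl, map_zero])
      (constantCoeff_posSum C r q _ l) (commute_map_algebraMap _ _), expSeries_map_algebraMap,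
      expScalar_apply, mul_assoc]
  · change map _ (expSeries _) = expSeries _
    rw [← expSeries_map]
    congr 1
    ext d
    rw [coeff_map, cSeries, coeff_mk]
    split_ifs
    · refine (map_smul τ _ _).trans ?_
      exact congrArg _ (hc _)
    · exact map_zero _

variable (C r q) (s : ℕ)

/-- The generators `Ỹ_{i,l}` and `Ã_{i,l}⁻¹`. -/
abbrev Letter (n s : ℕ) : Type := Kind n × ZMod s

/-- The element `Ỹ_{i,l}` or `Ã_{i,l}⁻¹` named by a letter. -/
noncomputable def letter : Letter n s → (Heis C r q)⟦X⟧ˣ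
  | (Sum.inl i, l) => current C r q (Sum.inl i) l.cast
  | (Sum.inr i, l) => (current C r q (Sum.inr i) l.cast)⁻¹

/-- The exponent of a current in a letter. -/
def Kind.sign : Kind n → ℂ
  | Sum.inl _ => 1
  | Sum.inr _ => -1

theorem Kind.sign_ne_zero (b : Kind n) : Kind.sign b ≠ 0 := by
  rcases b with i | i <;> simp [Kind.sign]

/-- The logarithm of the eigenvalue of a letter under the translation by `θ`. -/
noncomputable def letterChar (x : Letter n s) : (Kind n → ℕ → ℂ) →+ (ℕ → ℂ) where
  toFun θ m := Kind.sign x.1 * (((q ^ ((x.2.cast : ℤ) * (m : ℤ)) : ℂˣ) : ℂ) * θ x.1 m)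
  map_zero' := by funext m; simp
  map_add' θ θ' := by funext m; simp only [Pi.add_apply]; ring

/-- The eigenvalue, as a function of the translation, of the words with a given multiset of
letters. -/
noncomputable def wordChar (μ : Multiset (Letter n s)) :
    Multiplicative (Kind n → ℕ → ℂ) →* ℂ⟦X⟧ :=
  expScalar.comp (AddMonoidHom.toMultiplicative (μ.map (letterChar q s)).sum)

theorem wordChar_zero (θ : Multiplicative (Kind n → ℕ → ℂ)) :
    wordChar q s (0 : Multiset (Letter n s)) θ = 1 :=
  map_one expScalar

theorem wordChar_cons (x : Letter n s) (μ : Multiset (Letter n s)) (θ : Kind n → ℕ → ℂ) :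
    wordChar q s (x ::ₘ μ) (Multiplicative.ofAdd θ) =
      expScalar (Multiplicative.ofAdd (letterChar q s x θ)) *
        wordChar q s μ (Multiplicative.ofAdd θ) := by
  rw [wordChar, wordChar, Multiset.map_cons, Multiset.sum_cons]
  exact map_mul expScalar (Multiplicative.ofAdd (letterChar q s x θ))
    (Multiplicative.ofAdd ((μ.map (letterChar q s)).sum θ))

variable {C r q}

theorem map_letter {θ : Kind n → ℕ → ℂ} {τ : Heis C r q →+* Heis C r q}
    (hτ : ∀ b l, map τ (current C r q b l) =
        map (algebraMap ℂ _) (expScalar (Multiplicative.ofAdd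
          fun m : ℕ => ((q ^ (l * (m : ℤ)) : ℂˣ) : ℂ) * θ b m)) *
            (current C r q b l : (Heis C r q)⟦X⟧))
    (x : Letter n s) :
    map τ (letter C r q s x) =
      map (algebraMap ℂ _) (expScalar (Multiplicative.ofAdd (letterChar q s x θ))) *
        (letter C r q s x : (Heis C r q)⟦X⟧) := by
  obtain ⟨i | i, l⟩ := x
  · refine (hτ _ _).trans ?_
    congr 4
    funext m
    exact (one_mul _).symm
  · set w : ℕ → ℂ := fun m : ℕ => ((q ^ ((l.cast : ℤ) * (m : ℤ)) : ℂˣ) : ℂ) * θ (Sum.inr i) m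
    set a := current C r q (Sum.inr i) l.cast with ha
    have hw : letterChar q s (Sum.inr i, l) θ = -w := by
      funext m
      exact neg_one_mul _
    have h1 : map τ (a : (Heis C r q)⟦X⟧) * map τ (↑a⁻¹ : (Heis C r q)⟦X⟧) = 1 := by
      rw [← map_mul, Units.mul_inv, map_one]
    have h2 : map (algebraMap ℂ (Heis C r q)) (expScalar (Multiplicative.ofAdd (-w))) *
        map (algebraMap ℂ (Heis C r q)) (expScalar (Multiplicative.ofAdd w)) = 1 := by
      rw [← map_mul, ← map_mul, ← ofAdd_add, neg_add_cancel, ofAdd_zero, map_one, map_one]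
    rw [hw]
    change map τ (↑a⁻¹ : (Heis C r q)⟦X⟧) = _ * (↑a⁻¹ : (Heis C r q)⟦X⟧)
    rw [(commute_map_algebraMap _ _).eq, Units.eq_inv_mul_iff_mul_eq]
    rw [hτ] at h1
    calc (a : (Heis C r q)⟦X⟧) * map τ (↑a⁻¹ : (Heis C r q)⟦X⟧)
        = (map (algebraMap ℂ (Heis C r q)) (expScalar (Multiplicative.ofAdd (-w))) *
          map (algebraMap ℂ (Heis C r q)) (expScalar (Multiplicative.ofAdd w))) *
          (a * map τ (↑a⁻¹ : (Heis C r q)⟦X⟧)) := by rw [h2, one_mul]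
      _ = _ := by rw [mul_assoc, ← mul_assoc _ (a : (Heis C r q)⟦X⟧), h1, mul_one]

theorem map_prod_letter {θ : Kind n → ℕ → ℂ} {τ : Heis C r q →+* Heis C r q}
    (hτ : ∀ b l, map τ (current C r q b l) =
        map (algebraMap ℂ _) (expScalar (Multiplicative.ofAdd
          fun m : ℕ => ((q ^ (l * (m : ℤ)) : ℂˣ) : ℂ) * θ b m)) *
            (current C r q b l : (Heis C r q)⟦X⟧))
    (w : List (Letter n s)) :
    map τ (w.map fun x => (letter C r q s x : (Heis C r q)⟦X⟧)).prod =
      map (algebraMap ℂ _) (wordChar q s (w : Multiset (Letter n s)) (Multiplicative.ofAdd θ)) *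
        (w.map fun x => (letter C r q s x : (Heis C r q)⟦X⟧)).prod := by
  induction w with
  | nil =>
    rw [Multiset.coe_nil, wordChar_zero]
    simp
  | cons x w ih =>
    rw [List.map_cons, List.prod_cons, map_mul, ih, map_letter s hτ, ← Multiset.cons_coe,
      wordChar_cons, map_mul, mul_assoc, mul_assoc]
    congr 1
    rw [← mul_assoc, ← (commute_map_algebraMap _ _).eq, mul_assoc]

end Translation

section Injectivity

variable {n : ℕ} {q : ℂˣ} {s : ℕ}

/-- The functions `m ↦ q ^ (l m)` on `m > 0` are linearly independent for distinct `l ∈ ℤ/sℤ`. -/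
theorem eq_zero_of_powerSums_eq_zero (hs : IsPrimitiveRoot q s) {κ : ZMod s →₀ ℤ}
    (h : ∀ m : ℕ, 0 < m → powerSums q s κ m = 0) : κ = 0 := by
  have hinj : Function.Injective fun l : ZMod s =>
      powersHom ℂ ((q ^ (l.cast : ℤ) : ℂˣ) : ℂ) := by
    intro l l' hl
    have h1 : q ^ (l.cast : ℤ) = q ^ (l'.cast : ℤ) := Units.ext ((powersHom ℂ).injective hl)
    have h2 : q ^ ((l.cast : ℤ) - (l'.cast : ℤ)) = 1 := by
      rw [zpow_sub, h1, mul_inv_cancel]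
    have h3 := (ZMod.intCast_eq_intCast_iff_dvd_sub (l'.cast : ℤ) (l.cast : ℤ) s).2
      (hs.zpow_eq_one_iff_dvd _ |>.1 h2)
    simpa using h3.symm
  -- The factor `q ^ l` in the coefficients accounts for the missing value at `m = 0`.
  have hlin := linearIndependent_iff'.1
    ((linearIndependent_monoidHom (Multiplicative ℕ) ℂ).comp _ hinj) κ.support
    (fun l => (κ l : ℂ) * ((q ^ (l.cast : ℤ) : ℂˣ) : ℂ)) (by
      funext m
      refine Eq.trans ?_ (h (m.toAdd + 1) (Nat.succ_pos _))
      rw [powerSums_apply, Finset.sum_apply]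
      refine Finset.sum_congr rfl fun l _ => ?_
      rw [Function.comp_apply, Pi.smul_apply, smul_eq_mul, powersHom_apply, mul_assoc,
        ← Units.val_pow_eq_pow_val, ← Units.val_mul, ← zpow_natCast, ← zpow_mul, ← zpow_add]
      congr 3
      push_cast
      ring)
  ext l
  by_contra hl
  have := hlin l (Finsupp.mem_support_iff.2 hl)
  rcases mul_eq_zero.1 this with h0 | h0
  · exact hl (by exact_mod_cast h0)
  · exact (Units.ne_zero _) h0

/-- The translation of a single mode `b[m]` reads off, up to sign, the power sum `∑_l μ_l q ^ (l m)`
of the multiplicities of the letters of kind `b`. -/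
theorem injective_wordChar (hs : IsPrimitiveRoot q s) :
    Function.Injective (wordChar (n := n) q s) := by
  classical
  -- `cnt b μ` records the multiplicities in `μ` of the letters of kind `b`.
  let cnt : Kind n → Multiset (Letter n s) → (ZMod s →₀ ℤ) := fun b μ =>
    (μ.map fun x => if x.1 = b then Finsupp.single x.2 (1 : ℤ) else 0).sum
  have hcnt : ∀ b l μ, cnt b μ l = (μ.count (b, l) : ℤ) := by
    intro b l μ
    induction μ using Multiset.induction_on with
    | empty => simp [cnt]
    | cons x μ ih =>
      obtain ⟨b', l'⟩ := x
      have : cnt b ((b', l') ::ₘ μ) = (if b' = b then Finsupp.single l' (1 : ℤ) else 0) + cnt b μ := by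
        simp only [cnt, Multiset.map_cons, Multiset.sum_cons]
      rw [this, Finsupp.add_apply, ih, Multiset.count_cons]
      by_cases hb : b' = b
      · subst hb
        by_cases hl : l' = l
        · subst hl
          simp [add_comm]
        · have : ¬ l = l' := fun h => hl h.symm
          simp [this]
      · have : ¬ b = b' := fun h => hb h.symm
        simp [hb, this]
  have hchar : ∀ b (m : ℕ) μ, 0 < m →
      (wordChar q s μ (Multiplicative.ofAdd (Pi.single b (Pi.single m 1)))).coeff m =
        Kind.sign b * powerSums q s (cnt b μ) m := by
    intro b m μ hm
    have : (μ.map (letterChar q s)).sum (Pi.single b (Pi.single m 1)) =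
        Pi.single m (Kind.sign b * powerSums q s (cnt b μ) m) := by
      induction μ using Multiset.induction_on with
      | empty => simp [cnt]
      | cons x μ ih =>
        rw [Multiset.map_cons, Multiset.sum_cons, AddMonoidHom.add_apply, ih]
        have h1 : cnt b (x ::ₘ μ) = (if x.1 = b then Finsupp.single x.2 (1 : ℤ) else 0) + cnt b μ := by
          simp only [cnt, Multiset.map_cons, Multiset.sum_cons]
        rw [h1, map_add, Pi.add_apply, mul_add, Pi.single_add]
        congr 1
        funext d
        by_cases hb : x.1 = b
        · subst hb
          rw [if_pos rfl, powerSums_single]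
          by_cases hd : d = m
          · subst hd
            simp [letterChar]
          · simp [letterChar, hd]
        · simp [letterChar, hb]
    have h2 : wordChar q s μ (Multiplicative.ofAdd (Pi.single b (Pi.single m 1))) =
        expScalar (Multiplicative.ofAdd
          ((μ.map (letterChar q s)).sum (Pi.single b (Pi.single m 1)))) := rfl
    rw [h2, this, coeff_expScalar_single hm]
  intro μ ν h
  refine Multiset.ext.2 fun ⟨b, l⟩ => ?_
  have : cnt b μ - cnt b ν = 0 := eq_zero_of_powerSums_eq_zero hs fun m hm => by
    have h1 := hchar b m μ hm
    rw [h, hchar b m ν hm] at h1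
    rw [map_sub, Pi.sub_apply, mul_left_cancel₀ (Kind.sign_ne_zero b) h1, sub_self]
  have h2 := congrArg (fun κ => κ l) (sub_eq_zero.1 this)
  simp only [hcnt] at h2
  exact_mod_cast h2

/-- The scalar by which `∏_l t_l ^ κ_l` acts on the Fock space, as a function of the
central charges `γ`. -/
noncomputable def chargeChar (q : ℂˣ) (s : ℕ) (κ : ZMod s →₀ ℤ) :
    Multiplicative (ℕ → ℂ) →* ℂ⟦X⟧ :=
  expScalar.comp (AddMonoidHom.toMultiplicative
    { toFun := fun γ d => if Even d then powerSums q s κ (d / 2) * γ (d / 2) else 0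
      map_zero' := by funext d; simp
      map_add' := fun γ γ' => by
        funext d
        simp only [Pi.add_apply]
        split_ifs
        · ring
        · simp })

theorem chargeChar_apply (κ : ZMod s →₀ ℤ) (γ : ℕ → ℂ) :
    chargeChar q s κ (Multiplicative.ofAdd γ) = expScalar (Multiplicative.ofAdd fun d =>
      if Even d then powerSums q s κ (d / 2) * γ (d / 2) else 0) := rfl

theorem injective_chargeChar (hs : IsPrimitiveRoot q s) : Function.Injective (chargeChar q s) := by
  have hchar : ∀ κ (m : ℕ), 0 < m →
      (chargeChar q s κ (Multiplicative.ofAdd (Pi.single m 1))).coeff (2 * m) =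
        powerSums q s κ m := by
    intro κ m hm
    rw [chargeChar_apply, ← coeff_expScalar_single (m := 2 * m) (by omega) (powerSums q s κ m)]
    congr 3
    funext d
    by_cases hd : d = 2 * m
    · subst hd
      simp
    · rw [Pi.single_eq_of_ne hd]
      split_ifs with he
      · rw [Pi.single_eq_of_ne (by obtain ⟨e, rfl⟩ := he; omega), mul_zero]
      · rfl
  intro κ κ' h
  refine sub_eq_zero.1 (eq_zero_of_powerSums_eq_zero hs fun m hm => ?_)
  rw [map_sub, Pi.sub_apply, ← hchar κ m hm, ← hchar κ' m hm, h, sub_self]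

end Injectivity

section TMonomial

open PowerSeries

variable {n : ℕ} {C : Matrix (Fin n) (Fin n) ℤ} {r : Fin n → ℕ} {q : ℂˣ} {s : ℕ}

/-- The Laurent monomials in the `t_l` are linearly independent: on Fock spaces they act through
distinct characters of the group of central charges. -/
theorem linearIndependent_tMonomial (hB : (symZ C r).IsSymm) (hs : IsPrimitiveRoot q s)
    (S : Finset (ZMod s →₀ ℤ)) (z : (ZMod s →₀ ℤ) → ℤ)
    (h : ∑ κ ∈ S, z κ • tMonomial C r q s (Multiplicative.ofAdd κ) = 0) : ∀ κ ∈ S, z κ = 0 := by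
  intro κ hκ
  have key := eq_zero_of_sum_character_mul_eq_zero (A := Module.End ℂ (Fock n)) (chargeChar q s)
    (injective_chargeChar hs) S (fun κ => (z κ : (Module.End ℂ (Fock n))⟦X⟧)) (fun γ => by
      obtain ⟨ρ, hρ⟩ := Heis.exists_fock (q := q) hB γ.toAdd
      have := congrArg (map (ρ : Heis C r q →+* Module.End ℂ (Fock n))) h
      rw [map_sum, map_zero] at this
      rw [← this]
      refine Finset.sum_congr rfl fun κ _ => ?_
      rw [map_zsmul, zsmul_eq_mul, (commute_map_algebraMap _ _).eq]
      congr 1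
      change map (algebraMap ℂ _) (chargeChar q s κ (Multiplicative.ofAdd γ.toAdd)) =
        map (ρ : Heis C r q →+* Module.End ℂ (Fock n)) (expSeries (cSeries C r q (powerSums q s κ)))
      rw [chargeChar_apply, expScalar_apply, ← expSeries_map_algebraMap, ← expSeries_map]
      congr 1
      ext1 d
      rw [coeff_map, coeff_map, coeff_mk, cSeries, coeff_mk]
      by_cases hd : 0 < d / 2 ∧ Even d
      · rw [dif_pos hd, if_neg (by rintro rfl; simp at hd), if_pos hd.2]
        refine Eq.trans ?_ (map_smul ρ _ _).symm
        refine Eq.trans ?_ (congrArg _ (hρ _)).symm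
        rw [map_mul, Algebra.smul_def]
        rfl
      · rw [dif_neg hd, map_zero]
        by_cases h0 : d = 0
        · rw [if_pos h0, map_zero]
        · rw [if_neg h0, if_neg (fun he => hd ⟨by obtain ⟨e, rfl⟩ := he; omega, he⟩), map_zero]) κ hκ
  have h1 : ((z κ : Module.End ℂ (Fock n))) = 0 := by
    have := congrArg constantCoeff key
    rwa [map_intCast, map_zero] at this
  have h2 := congrArg (fun e : Module.End ℂ (Fock n) => MvPolynomial.constantCoeff (e 1)) h1
  have h3 : ((z κ : ℤ) : ℂ) = 0 := by
    rw [← map_intCast (algebraMap ℂ (Module.End ℂ (Fock n)))] at h2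
    simpa [Module.algebraMap_end_apply] using h2
  exact_mod_cast h3

end TMonomial

/-! ### The exponents of `t` -/

section Exponents

open LaurentPolynomial

variable {n : ℕ} {C : Matrix (Fin n) (Fin n) ℤ} {r : Fin n → ℕ} (s : ℕ)

theorem reduceExp_T_zero (k : ℤ) : reduceExp s (T k) 0 = if (k : ZMod s) = 0 then 1 else 0 := by
  rw [reduceExp_T, Finsupp.single_apply]

theorem reduceExp_invert_zero (P : ℤ[T;T⁻¹]) : reduceExp s (invert P) 0 = reduceExp s P 0 := by
  induction P using LaurentPolynomial.induction_on' with
  | add p q hp hq => rw [map_add, map_add, map_add, Finsupp.add_apply, Finsupp.add_apply, hp, hq]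
  | C_mul_T k a =>
    rw [map_mul, invert_C, invert_T, ← smul_eq_C_mul, ← smul_eq_C_mul, map_zsmul, map_zsmul,
      Finsupp.smul_apply, Finsupp.smul_apply, reduceExp_T_zero, reduceExp_T_zero, Int.cast_neg]
    simp only [neg_eq_zero]

theorem T_sub_T_mul_qInt (m : ℕ) :
    (T 1 - T (-1)) * qInt (m : ℤ) = (T (m : ℤ) - T (-(m : ℤ)) : ℤ[T;T⁻¹]) := by
  have h : qInt (m : ℤ) = ∑ k ∈ Finset.range m, T ((m : ℤ) - 1 - 2 * (k : ℤ)) := by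
    rw [qInt, Int.natAbs_natCast]
    rcases Nat.eq_zero_or_pos m with rfl | hm
    · simp
    · rw [Int.sign_eq_one_of_pos (by exact_mod_cast hm), one_smul]
  have h2 := Finset.sum_range_sub' (fun k : ℕ => (T ((m : ℤ) - 2 * (k : ℤ)) : ℤ[T;T⁻¹])) m
  rw [h, Finset.mul_sum, show (T (-(m : ℤ)) : ℤ[T;T⁻¹]) = T ((m : ℤ) - 2 * (m : ℤ)) by
    congr 1; ring]
  refine Eq.trans (Finset.sum_congr rfl fun k _ => ?_) (h2.trans (by simp))
  rw [sub_mul, ← T_add, ← T_add]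
  congr 2
  · ring
  · push_cast; ring

theorem qInt_of_nonpos {c : ℤ} (hc : c ≤ 0) :
    qInt c = -∑ e ∈ Finset.range (-c).toNat, T (-(c + 1 + 2 * (e : ℤ))) := by
  have h : c.natAbs = (-c).toNat := by omega
  have h' : ((-c).toNat : ℤ) = -c := by omega
  rw [qInt, h]
  rcases hc.eq_or_lt with rfl | hc
  · simp
  · rw [Int.sign_eq_neg_one_of_neg hc, neg_one_smul]
    congr 1
    refine Finset.sum_congr rfl fun e _ => ?_
    congr 1
    rw [h']
    ring

theorem pairing_inr_inr (i j : Fin n) : pairing C r (Sum.inr i) (Sum.inr j) =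
    (T (r i : ℤ) - T (-(r i : ℤ))) * cartanZ C r i j := by
  rw [pairing, symZ_apply, ← mul_assoc, T_sub_T_mul_qInt]

theorem commExp_zero (b b' : Kind n) (l k : ℤ) :
    commExp C r s b b' l k 0 = 2 * reduceExp s (T (l - k) * pairing C r b b') 0 := by
  rw [commExp, map_add, Finsupp.add_apply, reduceExp_invert_zero, two_mul]

variable {s}

theorem reduceExp_T_cast_zero (l k : ZMod s) (p : ℤ) :
    reduceExp s (T ((l.cast : ℤ) - (k.cast : ℤ) + p)) 0 = delta (l - k) ((-p : ℤ) : ZMod s) := by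
  rw [reduceExp_T_zero, delta]
  congr 1
  rw [Int.cast_add, Int.cast_sub, ZMod.intCast_zmod_cast, ZMod.intCast_zmod_cast, Int.cast_neg,
    eq_neg_iff_add_eq_zero]

theorem commExp_inr_inr (hC : IsGenCartan C) (i j : Fin n) (l k : ZMod s) :
    commExp C r s (Sum.inr i) (Sum.inr j) l.cast k.cast 0 = alpha C r s i l j k := by
  rw [commExp_zero, pairing_inr_inr, alpha, cartanZ, Matrix.of_apply]
  by_cases h : i = j
  · subst h
    have : (T ((l.cast : ℤ) - (k.cast : ℤ)) *
        ((T (r i : ℤ) - T (-(r i : ℤ))) * (T (r i : ℤ) + T (-(r i : ℤ)))) : ℤ[T;T⁻¹]) =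
        T ((l.cast : ℤ) - (k.cast : ℤ) + 2 * (r i : ℤ)) -
          T ((l.cast : ℤ) - (k.cast : ℤ) + -(2 * (r i : ℤ))) := by
      rw [T_add, T_add, two_mul, neg_add, T_add, T_add]
      ring
    rw [if_pos rfl, if_pos rfl, this, map_sub, Finsupp.sub_apply, reduceExp_T_cast_zero,
      reduceExp_T_cast_zero, neg_neg, neg_mul]
  · have : (T ((l.cast : ℤ) - (k.cast : ℤ)) *
        ((T (r i : ℤ) - T (-(r i : ℤ))) * qInt (C i j)) : ℤ[T;T⁻¹]) =
        ∑ e ∈ Finset.range (-C i j).toNat,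
          (T ((l.cast : ℤ) - (k.cast : ℤ) + -(C i j + 1 + 2 * (e : ℤ) + (r i : ℤ))) -
            T ((l.cast : ℤ) - (k.cast : ℤ) + -(C i j + 1 + 2 * (e : ℤ) - (r i : ℤ)))) := by
      rw [qInt_of_nonpos (hC.offdiag i j h), mul_neg, Finset.mul_sum, ← Finset.sum_neg_distrib,
        Finset.mul_sum]
      refine Finset.sum_congr rfl fun e _ => ?_
      rw [neg_add (C i j + 1 + 2 * (e : ℤ)), neg_sub, sub_eq_neg_add (r i : ℤ), ← add_assoc,
        ← add_assoc, T_add _ (r i : ℤ), T_add _ (-(r i : ℤ)), T_add ((l.cast : ℤ) - (k.cast : ℤ))]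
      ring
    rw [if_neg h, if_neg h, this, map_sum, Finsupp.finsetSum_apply]
    refine congrArg _ (Finset.sum_congr rfl fun e _ => ?_)
    rw [map_sub, Finsupp.sub_apply, reduceExp_T_cast_zero, reduceExp_T_cast_zero, neg_neg, neg_neg]

theorem commExp_inr_inl (i j : Fin n) (l k : ZMod s) :
    commExp C r s (Sum.inr i) (Sum.inl j) l.cast k.cast 0 = beta r s i l j k := by
  rw [commExp_zero, pairing, beta]
  by_cases h : i = j
  · rw [if_pos h, if_pos h, mul_sub, ← T_add, ← T_add, map_sub, Finsupp.sub_apply,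
      reduceExp_T_cast_zero, reduceExp_T_cast_zero, neg_neg]
    ring
  · rw [if_neg h, if_neg h, mul_zero (LaurentPolynomial.T _), map_zero (reduceExp s), Finsupp.zero_apply]
    simp

end Exponents

/-! ### Words in the generators -/

section Words

variable {n : ℕ} (C : Matrix (Fin n) (Fin n) ℤ) (r : Fin n → ℕ) (s : ℕ)

/-- The exponents in the commutation relations between the letters. -/
noncomputable def letterExp : Letter n s → Letter n s → (ZMod s →₀ ℤ)
  | (Sum.inl _, _), (Sum.inl _, _) => 0
  | (Sum.inr i, l), (Sum.inr j, k) => commExp C r s (Sum.inr i) (Sum.inr j) l.cast k.cast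
  | (Sum.inl j, k), (Sum.inr i, l) => commExp C r s (Sum.inr i) (Sum.inl j) l.cast k.cast
  | (Sum.inr i, l), (Sum.inl j, k) => -commExp C r s (Sum.inr i) (Sum.inl j) l.cast k.cast

variable {C r s}

theorem letter_mul_letter {q : ℂˣ} (hB : (symZ C r).IsSymm) (hs : IsPrimitiveRoot q s)
    (x y : Letter n s) :
    (letter C r q s x * letter C r q s y : (Heis C r q)⟦X⟧) =
      tMonomial C r q s (Multiplicative.ofAdd (letterExp C r s x y)) *
        (letter C r q s y * letter C r q s x) := by
  -- Every case is an identity in the group of units.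
  let t : Multiplicative (ZMod s →₀ ℤ) →* (Heis C r q)⟦X⟧ˣ := (tMonomial C r q s).toHomUnits
  have hcur : ∀ (b b' : Kind n) (l k : ZMod s),
      current C r q b l.cast * current C r q b' k.cast =
        t (Multiplicative.ofAdd (commExp C r s b b' l.cast k.cast)) *
          (current C r q b' k.cast * current C r q b l.cast) := fun b b' l k =>
    Units.ext (current_mul_current_eq_tMonomial hB hs b b' _ _)
  have ht : ∀ κ u, t κ * u = u * t κ := fun κ u => Units.ext (commute_tMonomial C r q s κ u).eq
  suffices h : letter C r q s x * letter C r q s y =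
      t (Multiplicative.ofAdd (letterExp C r s x y)) * (letter C r q s y * letter C r q s x) from
    congrArg Units.val h
  have hYA : ∀ (i j : Fin n) (l k : ZMod s),
      letter C r q s (Sum.inl j, k) * letter C r q s (Sum.inr i, l) =
        t (Multiplicative.ofAdd (commExp C r s (Sum.inr i) (Sum.inl j) l.cast k.cast)) *
          (letter C r q s (Sum.inr i, l) * letter C r q s (Sum.inl j, k)) := by
    intro i j l k
    have := hcur (Sum.inr i) (Sum.inl j) l k
    simp only [letter]
    rw [← mul_assoc, ht, mul_assoc, eq_inv_mul_iff_mul_eq, ← mul_assoc, this, ← mul_assoc,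
      mul_assoc, mul_inv_cancel, mul_one]
  obtain ⟨i | i, l⟩ := x <;> obtain ⟨j | j, k⟩ := y
  · have := hcur (Sum.inl i) (Sum.inl j) l k
    have h0 : commExp C r s (Sum.inl i) (Sum.inl j) l.cast k.cast = 0 := by
      rw [commExp, pairing, mul_zero, map_zero, add_zero, map_zero]
    rw [h0] at this
    exact this
  · exact hYA j i k l
  · rw [letterExp, hYA i j l k, ofAdd_neg, map_inv, inv_mul_cancel_left]
  · have := hcur (Sum.inr i) (Sum.inr j) l k
    simp only [letter, letterExp]
    rw [← mul_inv_rev, ← mul_inv_rev, this, ht, mul_inv_rev (t _), inv_mul_cancel_right]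

/-- The monomials `t^κ w`, where `w` is a word in the letters. -/
abbrev Monomials (n s : ℕ) : Type := Multiplicative (ZMod s →₀ ℤ) × FreeMonoid (Letter n s)

/-- Evaluation of monomials in a monoid. -/
noncomputable def evalMonomial {Q : Type*} [Monoid Q] (T : Multiplicative (ZMod s →₀ ℤ) →* Q)
    (b : Letter n s → Q) (h : ∀ κ x, Commute (T κ) (b x)) : Monomials n s →* Q :=
  T.noncommCoprod (FreeMonoid.lift b) fun κ w => by
    rw [FreeMonoid.lift_apply]
    exact Commute.list_prod_right _ _ fun y hy => by
      obtain ⟨x, _, rfl⟩ := List.mem_map.1 hy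
      exact h κ x

theorem evalMonomial_apply {Q : Type*} [Monoid Q] (T : Multiplicative (ZMod s →₀ ℤ) →* Q)
    (b : Letter n s → Q) (h : ∀ κ x, Commute (T κ) (b x)) (m : Monomials n s) :
    evalMonomial T b h m = T m.1 * (m.2.toList.map b).prod := by
  rw [evalMonomial, MonoidHom.noncommCoprod_apply, FreeMonoid.lift_apply]

/-- Words with the same letters agree up to a power of the `t_l`. -/
theorem exists_prod_eq_of_perm {Q : Type*} [Monoid Q] {T : Multiplicative (ZMod s →₀ ℤ) →* Q}
    {b : Letter n s → Q} (h : ∀ κ x, Commute (T κ) (b x))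
    (hb : ∀ x y, ∃ κ, b x * b y = T κ * (b y * b x)) {w w' : List (Letter n s)}
    (hw : w.Perm w') : ∃ κ, (w.map b).prod = T κ * (w'.map b).prod := by
  induction hw with
  | nil => exact ⟨1, by simp⟩
  | cons x _ ih =>
    obtain ⟨κ, hκ⟩ := ih
    refine ⟨κ, ?_⟩
    rw [List.map_cons, List.map_cons, List.prod_cons, List.prod_cons, hκ, ← mul_assoc,
      ← (h κ x).eq, mul_assoc]
  | swap x y l =>
    obtain ⟨κ, hκ⟩ := hb y x
    refine ⟨κ, ?_⟩
    simp only [List.map_cons, List.prod_cons]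
    rw [← mul_assoc, hκ, mul_assoc, mul_assoc]
  | trans _ _ ih₁ ih₂ =>
    obtain ⟨κ₁, h₁⟩ := ih₁
    obtain ⟨κ₂, h₂⟩ := ih₂
    exact ⟨κ₁ * κ₂, by rw [h₁, h₂, map_mul, mul_assoc]⟩

/-- `κ ↦ t ^ κ_0`, the specialization `t_0 = t` and `t_l = 1` for `l ≠ 0`. -/
noncomputable def tSpecial {R : Type*} [Monoid R] (t : Rˣ) : Multiplicative (ZMod s →₀ ℤ) →* R :=
  (Units.coeHom R).comp
    ((zpowersHom Rˣ t).comp (AddMonoidHom.toMultiplicative (Finsupp.applyAddHom (0 : ZMod s))))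

theorem tSpecial_apply {R : Type*} [Monoid R] (t : Rˣ) (κ : ZMod s →₀ ℤ) :
    tSpecial t (Multiplicative.ofAdd κ) = ((t ^ κ 0 : Rˣ) : R) := rfl

variable (C r) in
/-- Letters in a monoid satisfying the `t`-commutation relations with a central unit `t`. -/
structure TCommute {R : Type*} [Monoid R] (t : Rˣ) (b : Letter n s → R) : Prop where
  central : ∀ x, Commute (t : R) (b x)
  comm : ∀ x y, b x * b y = ((t ^ letterExp C r s x y 0 : Rˣ) : R) * (b y * b x)

theorem TCommute.commute_tSpecial {R : Type*} [Monoid R] {t : Rˣ} {b : Letter n s → R}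
    (h : TCommute C r t b) (κ : Multiplicative (ZMod s →₀ ℤ)) (x : Letter n s) :
    Commute (tSpecial t κ) (b x) :=
  Commute.units_zpow_left (h.central x) _

theorem sum_smul_comp {ι K Q : Type*} [DecidableEq K] [AddCommGroup Q] (F : Finset ι) (z : ι → ℤ)
    (κ : ι → K) (T : K → Q) :
    ∑ m ∈ F, z m • T (κ m) = ∑ k ∈ F.image κ, (∑ m ∈ F with κ m = k, z m) • T k := by
  rw [← Finset.sum_fiberwise_of_maps_to (g := κ) (t := F.image κ)
    fun m hm => Finset.mem_image_of_mem _ hm]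
  refine Finset.sum_congr rfl fun k _ => ?_
  rw [Finset.sum_smul]
  refine Finset.sum_congr rfl fun m hm => ?_
  rw [(Finset.mem_filter.1 hm).2]

variable {q : ℂˣ}

/-- A linear relation between the monomials `t^κ w` in the Heisenberg series holds in any ring with
the `t`-commutation relations: independence of characters separates first words with different
letters, then different monomials in the `t_l`. -/
theorem lift_tSpecial_eq_zero (hB : (symZ C r).IsSymm) (hs : IsPrimitiveRoot q s)
    {R : Type*} [Ring R] {t : Rˣ} {b : Letter n s → R} (h : TCommute C r t b)
    (f : MonoidAlgebra ℤ (Monomials n s))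
    (hf : MonoidAlgebra.lift ℤ (Heis C r q)⟦X⟧ (Monomials n s) (evalMonomial (tMonomial C r q s)
      (fun x => (letter C r q s x : (Heis C r q)⟦X⟧)) fun _ _ => commute_tMonomial C r q s _ _)
        f = 0) :
    MonoidAlgebra.lift ℤ R (Monomials n s) (evalMonomial (tSpecial t) b h.commute_tSpecial) f =
      0 := by
  classical
  set u := evalMonomial (tMonomial C r q s)
      (fun x => (letter C r q s x : (Heis C r q)⟦X⟧)) fun _ _ => commute_tMonomial C r q s _ _ with hu
  set p := evalMonomial (tSpecial t) b h.commute_tSpecial with hp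
  let wt : Monomials n s → Multiset (Letter n s) := fun m => (m.2.toList : Multiset (Letter n s))
  rw [MonoidAlgebra.lift_apply, Finsupp.sum] at hf ⊢
  rw [← Finset.sum_fiberwise_of_maps_to (g := wt) (t := f.coeff.support.image wt)
    fun m hm => Finset.mem_image_of_mem _ hm] at hf ⊢
  -- Separate words with different letters by translations.
  have hwt := eq_zero_of_sum_character_mul_eq_zero (wordChar q s) (injective_wordChar hs) _
    (fun μ => ∑ m ∈ f.coeff.support with wt m = μ, f.coeff m • u m)
    (fun θ => by
      obtain ⟨τ, hτ, hτc⟩ := exists_translation_current (C := C) (r := r) (q := q) θ.toAdd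
      have := congrArg (PowerSeries.map (τ : Heis C r q →+* Heis C r q)) hf
      rw [map_sum, map_zero] at this
      rw [← this]
      refine Finset.sum_congr rfl fun μ _ => ?_
      rw [map_sum, Finset.mul_sum]
      refine Finset.sum_congr rfl fun m hm => ?_
      obtain rfl := (Finset.mem_filter.1 hm).2
      rw [mul_smul_comm]
      refine Eq.trans (congrArg _ ?_) (map_zsmul _ _ _).symm
      rw [hu, evalMonomial_apply, map_mul, map_prod_letter s hτ]
      have hT : PowerSeries.map (τ : Heis C r q →+* Heis C r q) (tMonomial C r q s m.1) =
          tMonomial C r q s m.1 := hτc _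
      rw [hT, ← mul_assoc, ← mul_assoc, (commute_map_algebraMap _ _).eq]
      rfl)
  refine Finset.sum_eq_zero fun μ hμ => ?_
  have hμ0 := hwt μ hμ
  set F := f.coeff.support.filter fun m => wt m = μ
  -- All words with letters `μ` are multiples of a single one.
  let w₀ : List (Letter n s) := μ.toList
  have hκ : ∀ m : Monomials n s, ∃ κ : ZMod s →₀ ℤ, wt m = μ →
      u m = tMonomial C r q s (Multiplicative.ofAdd κ) *
        (w₀.map fun x => (letter C r q s x : (Heis C r q)⟦X⟧)).prod ∧
      p m = tSpecial t (Multiplicative.ofAdd κ) * (w₀.map b).prod := by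
    intro m
    by_cases hm : wt m = μ
    swap
    · exact ⟨0, fun h => absurd h hm⟩
    have hperm : m.2.toList.Perm w₀ := Multiset.coe_eq_coe.1 (hm.trans μ.coe_toList.symm)
    -- In the product of the two monoids the same `κ` serves on both sides.
    obtain ⟨κ, hκ⟩ := exists_prod_eq_of_perm
      (T := (tMonomial C r q s).prod (tSpecial t))
      (b := fun x => ((letter C r q s x : (Heis C r q)⟦X⟧), b x))
      (fun κ x => Prod.ext (commute_tMonomial C r q s _ _).eq (h.commute_tSpecial _ _).eq)
      (fun x y => ⟨Multiplicative.ofAdd (letterExp C r s x y),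
        Prod.ext (letter_mul_letter hB hs x y) (h.comm x y)⟩) hperm
    refine ⟨m.1.toAdd + κ.toAdd, fun _ => ⟨?_, ?_⟩⟩
    · have := congrArg (MonoidHom.fst _ _) hκ
      rw [map_mul, map_list_prod, map_list_prod, List.map_map, List.map_map] at this
      rw [hu, evalMonomial_apply, ofAdd_add, map_mul, mul_assoc]
      exact congrArg _ this
    · have := congrArg (MonoidHom.snd _ _) hκ
      rw [map_mul, map_list_prod, map_list_prod, List.map_map, List.map_map] at this
      rw [hp, evalMonomial_apply, ofAdd_add, map_mul, mul_assoc]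
      exact congrArg _ this
  choose κ hκ using hκ
  have hunit : IsUnit (w₀.map fun x => (letter C r q s x : (Heis C r q)⟦X⟧)).prod := by
    refine ⟨(w₀.map (letter C r q s)).prod, ?_⟩
    rw [← Units.coeHom_apply, map_list_prod, List.map_map]
    rfl
  -- Separate the monomials in the `t_l`.
  have h1 : ∑ m ∈ F, f.coeff m • tMonomial C r q s (Multiplicative.ofAdd (κ m)) = 0 := by
    rw [← hunit.mul_left_eq_zero, Finset.sum_mul, ← hμ0]
    refine Finset.sum_congr rfl fun m hm => ?_
    rw [(hκ m (Finset.mem_filter.1 hm).2).1, smul_mul_assoc]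
  rw [sum_smul_comp F f.coeff κ fun k => tMonomial C r q s (Multiplicative.ofAdd k)] at h1
  have h2 := linearIndependent_tMonomial hB hs _ _ h1
  have h3 : ∑ m ∈ F, f.coeff m • tSpecial t (Multiplicative.ofAdd (κ m)) = 0 := by
    rw [sum_smul_comp F f.coeff κ fun k => tSpecial t (Multiplicative.ofAdd k)]
    exact Finset.sum_eq_zero fun k hk => by rw [h2 k hk, zero_smul]
  calc ∑ m ∈ F, f.coeff m • p m
      = ∑ m ∈ F, f.coeff m • tSpecial t (Multiplicative.ofAdd (κ m)) * (w₀.map b).prod :=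
        Finset.sum_congr rfl fun m hm => by
          rw [(hκ m (Finset.mem_filter.1 hm).2).2, smul_mul_assoc]
    _ = 0 := by rw [← Finset.sum_mul, h3, zero_mul]

end Words

/-! ### The presented ring -/

section Presented

variable {n : ℕ} (C : Matrix (Fin n) (Fin n) ℤ) (r : Fin n → ℕ) (s : ℕ)

/-- `t` as a unit of the presented ring. -/
noncomputable def presT : (Pres C r s)ˣ where
  val := Pres.of C r s PresGen.t
  inv := Pres.of C r s PresGen.tInv
  val_inv := by
    rw [Pres.of, Pres.of, ← map_mul, RingQuot.mkRingHom_rel PresRel.t_mul_tInv, map_one]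
  inv_val := by
    rw [Pres.of, Pres.of, ← map_mul, RingQuot.mkRingHom_rel PresRel.tInv_mul_t, map_one]

/-- The generator of the presented ring named by a letter. -/
noncomputable def presLetter : Letter n s → Pres C r s
  | (Sum.inl i, l) => Pres.of C r s (PresGen.Y i l)
  | (Sum.inr i, l) => Pres.of C r s (PresGen.Ainv i l)

theorem map_tPow {R : Type*} [Ring R] (f : FreeAlgebra ℤ (PresGen n s) →+* R) (t : Rˣ)
    (h : f PresGen.t.ι = t) (h' : f PresGen.tInv.ι = ↑t⁻¹) (e : ℤ) :
    f (PresGen.tPow e) = ((t ^ e : Rˣ) : R) := by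
  rw [PresGen.tPow]
  split_ifs with he
  · obtain ⟨k, rfl⟩ := Int.eq_ofNat_of_zero_le he
    rw [map_pow, h, Int.toNat_natCast, zpow_natCast, Units.val_pow_eq_pow_val]
  · obtain ⟨k, hk⟩ := Int.eq_ofNat_of_zero_le (show 0 ≤ -e by omega)
    obtain rfl : e = -(k : ℤ) := by omega
    rw [map_pow, h', neg_neg, Int.toNat_natCast, zpow_neg, zpow_natCast, ← inv_pow,
      Units.val_pow_eq_pow_val]

variable {C r s}

theorem tCommute_pres (hC : IsGenCartan C) :
    TCommute C r (presT C r s) (presLetter C r s) := by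
  have hcent : ∀ g : PresGen n s, Commute (presT C r s : Pres C r s) (Pres.of C r s g) := by
    intro g
    have := RingQuot.mkRingHom_rel (PresRel.t_central (C := C) (r := r) g)
    rw [map_mul, map_mul] at this
    exact this
  have htPow : ∀ e, RingQuot.mkRingHom (PresRel C r s) (PresGen.tPow e) =
      ((presT C r s ^ e : (Pres C r s)ˣ) : Pres C r s) :=
    map_tPow s _ (presT C r s) rfl rfl
  have hYA : ∀ (i j : Fin n) (l k : ZMod s),
      presLetter C r s (Sum.inl j, k) * presLetter C r s (Sum.inr i, l) =
        ((presT C r s ^ beta r s i l j k : (Pres C r s)ˣ) : Pres C r s) *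
          (presLetter C r s (Sum.inr i, l) * presLetter C r s (Sum.inl j, k)) := by
    intro i j l k
    have := RingQuot.mkRingHom_rel (PresRel.YA (C := C) (r := r) i j l k)
    rw [map_mul, map_mul, map_mul, htPow, mul_assoc] at this
    exact this
  refine ⟨fun x => ?_, fun x y => ?_⟩
  · obtain ⟨i | i, l⟩ := x
    · exact hcent _
    · exact hcent _
  · obtain ⟨i | i, l⟩ := x <;> obtain ⟨j | j, k⟩ := y
    · have := RingQuot.mkRingHom_rel (PresRel.YY (C := C) (r := r) i j l k)
      rw [map_mul, map_mul] at this
      rw [letterExp, Finsupp.zero_apply, zpow_zero, Units.val_one, one_mul]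
      exact this
    · rw [letterExp, commExp_inr_inl]
      exact hYA j i k l
    · rw [letterExp, Finsupp.neg_apply, commExp_inr_inl, hYA, ← mul_assoc, ← Units.val_mul,
        ← zpow_add, neg_add_cancel, zpow_zero, Units.val_one, one_mul]
    · have := RingQuot.mkRingHom_rel (PresRel.AA (C := C) (r := r) i j l k)
      rw [map_mul, map_mul, map_mul, htPow, mul_assoc] at this
      rw [letterExp, commExp_inr_inr hC]
      exact this

/-- The universal property of the presented ring. -/
theorem exists_pres_lift (hC : IsGenCartan C) {R : Type*} [Ring R] {t : Rˣ} {b : Letter n s → R}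
    (h : TCommute C r t b) :
    ∃ φ : Pres C r s →+* R, (∀ x, φ (presLetter C r s x) = b x) ∧
      φ (Pres.of C r s PresGen.t) = t ∧ φ (Pres.of C r s PresGen.tInv) = ↑t⁻¹ := by
  let f : PresGen n s → R
    | PresGen.Y i l => b (Sum.inl i, l)
    | PresGen.Ainv i l => b (Sum.inr i, l)
    | PresGen.t => t
    | PresGen.tInv => ↑t⁻¹
  let F : FreeAlgebra ℤ (PresGen n s) →+* R := (FreeAlgebra.lift ℤ f : _ →ₐ[ℤ] R)
  have hF : ∀ g, F (PresGen.ι g) = f g := fun g => FreeAlgebra.lift_ι_apply f g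
  have htPow : ∀ e, F (PresGen.tPow e) = ((t ^ e : Rˣ) : R) := map_tPow s F t (hF _) (hF _)
  have hrel : ∀ ⦃x y⦄, PresRel C r s x y → F x = F y := by
    intro x y hxy
    induction hxy with
    | t_mul_tInv => rw [map_mul, map_one, hF, hF]; exact t.mul_inv
    | tInv_mul_t => rw [map_mul, map_one, hF, hF]; exact t.inv_mul
    | t_central g =>
      rw [map_mul, map_mul, hF, hF]
      cases g with
      | Y i l => exact (h.central _).eq
      | Ainv i l => exact (h.central _).eq
      | t => rfl
      | tInv => exact t.mul_inv.trans t.inv_mul.symm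
    | YY i j l k =>
      rw [map_mul, map_mul, hF, hF]
      refine (h.comm (Sum.inl i, l) (Sum.inl j, k)).trans ?_
      rw [letterExp, Finsupp.zero_apply, zpow_zero, Units.val_one, one_mul]
    | AA i j l k =>
      rw [map_mul, map_mul, map_mul, hF, hF, htPow, mul_assoc]
      refine (h.comm (Sum.inr i, l) (Sum.inr j, k)).trans ?_
      rw [letterExp, commExp_inr_inr hC]
    | YA i j l k =>
      rw [map_mul, map_mul, map_mul, hF, hF, htPow, mul_assoc]
      refine (h.comm (Sum.inl j, k) (Sum.inr i, l)).trans ?_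
      rw [letterExp, commExp_inr_inl]
  have hφ : ∀ g, RingQuot.lift ⟨F, hrel⟩ (Pres.of C r s g) = f g := fun g => by
    rw [Pres.of, RingQuot.lift_mkRingHom_apply, hF]
  refine ⟨RingQuot.lift ⟨F, hrel⟩, fun x => ?_, hφ _, hφ _⟩
  obtain ⟨i | i, l⟩ := x
  · exact hφ _
  · exact hφ _

theorem pres_hom_ext {R : Type*} [Ring R] {f g : Pres C r s →+* R}
    (h : ∀ x, f (presLetter C r s x) = g (presLetter C r s x))
    (ht : f (Pres.of C r s PresGen.t) = g (Pres.of C r s PresGen.t))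
    (ht' : f (Pres.of C r s PresGen.tInv) = g (Pres.of C r s PresGen.tInv)) : f = g := by
  refine RingQuot.ringQuot_ext f g (RingHom.ext fun x => ?_)
  induction x using FreeAlgebra.induction with
  | grade0 a => simp
  | grade1 a =>
    cases a with
    | Y i l => exact h (Sum.inl i, l)
    | Ainv i l => exact h (Sum.inr i, l)
    | t => exact ht
    | tInv => exact ht'
  | mul x y hx hy => rw [map_mul, map_mul, hx, hy]
  | add x y hx hy => rw [map_add, map_add, hx, hy]

end Presented

/-! ### The subquotient of the Heisenberg series -/

section Subquotient

variable {n : ℕ} (C : Matrix (Fin n) (Fin n) ℤ) (r : Fin n → ℕ) (q : ℂˣ) (s : ℕ)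

/-- The generator of `Ŷ_u^s` named by a letter. -/
noncomputable def yuLetter : Letter n s → Yu C r q s
  | (Sum.inl i, l) => Yu.Y C r q s i l
  | (Sum.inr i, l) => Yu.Ainv C r q s i l

theorem coe_yuLetter (x : Letter n s) :
    (yuLetter C r q s x : (Heis C r q)⟦X⟧) = letter C r q s x := by
  obtain ⟨i | i, l⟩ := x <;> rfl

theorem tMonomial_mem_Yu (κ : Multiplicative (ZMod s →₀ ℤ)) : tMonomial C r q s κ ∈ Yu C r q s := by
  have key : ∀ κ : ZMod s →₀ ℤ, tMonomial C r q s (Multiplicative.ofAdd κ) ∈ Yu C r q s := by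
    intro κ
    induction κ using Finsupp.induction_linear with
    | zero => rw [ofAdd_zero, map_one]; exact one_mem _
    | add f g hf hg => rw [ofAdd_add, map_mul]; exact mul_mem hf hg
    | single l a =>
      induction a using Int.induction_on with
      | zero => rw [Finsupp.single_zero, ofAdd_zero, map_one]; exact one_mem _
      | succ k ih =>
        rw [Finsupp.single_add, ofAdd_add, map_mul, tMonomial_single]
        exact mul_mem ih (Yu.t C r q s l).2
      | pred k ih =>
        rw [sub_eq_add_neg, Finsupp.single_add, ofAdd_add, map_mul, tMonomial_single_neg]
        exact mul_mem ih (Yu.tInv C r q s l).2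
  exact key κ.toAdd

/-- The Laurent monomials in the `t_l` in `Ŷ_u^s`. -/
noncomputable def yuT : Multiplicative (ZMod s →₀ ℤ) →* Yu C r q s :=
  (tMonomial C r q s).codRestrict (Yu C r q s) (tMonomial_mem_Yu C r q s)

theorem commute_yuT (κ : Multiplicative (ZMod s →₀ ℤ)) (x : Yu C r q s) :
    Commute (yuT C r q s κ) x :=
  Subtype.ext (commute_tMonomial C r q s κ x.1).eq

theorem yuT_single (l : ZMod s) :
    yuT C r q s (Multiplicative.ofAdd (Finsupp.single l 1)) = Yu.t C r q s l :=
  Subtype.ext (tMonomial_single C r q s l)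

theorem yuT_single_neg (l : ZMod s) :
    yuT C r q s (Multiplicative.ofAdd (Finsupp.single l (-1))) = Yu.tInv C r q s l :=
  Subtype.ext (tMonomial_single_neg C r q s l)

/-- The projection of the monoid ring of monomials onto `Ŷ_u^s`. -/
noncomputable def yuEval : MonoidAlgebra ℤ (Monomials n s) →+* Yu C r q s :=
  (MonoidAlgebra.lift ℤ (Yu C r q s) (Monomials n s)
    (evalMonomial (yuT C r q s) (yuLetter C r q s) fun _ _ => commute_yuT C r q s _ _) : _ →ₐ[ℤ] _)

theorem yuEval_of (m : Monomials n s) : yuEval C r q s (MonoidAlgebra.of ℤ _ m) =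
    yuT C r q s m.1 * (m.2.toList.map (yuLetter C r q s)).prod := by
  rw [← evalMonomial_apply _ _ fun _ _ => commute_yuT C r q s _ _]
  exact MonoidAlgebra.lift_of _ _

theorem coe_yuEval (f : MonoidAlgebra ℤ (Monomials n s)) :
    (yuEval C r q s f : (Heis C r q)⟦X⟧) =
      MonoidAlgebra.lift ℤ (Heis C r q)⟦X⟧ (Monomials n s) (evalMonomial (tMonomial C r q s)
        (fun x => (letter C r q s x : (Heis C r q)⟦X⟧)) fun _ _ => commute_tMonomial C r q s _ _)
          f := by
  induction f using MonoidAlgebra.induction_on with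
  | of m =>
    rw [yuEval_of, MonoidAlgebra.lift_of, evalMonomial_apply]
    refine congrArg₂ (· * ·) rfl ?_
    refine (map_list_prod (Yu C r q s).subtype _).trans ?_
    rw [List.map_map]
    congr 2
    funext x
    exact coe_yuLetter C r q s x
  | add f g hf hg => rw [map_add, map_add, ← hf, ← hg]; rfl
  | smul a f hf => rw [map_zsmul, map_zsmul, ← hf]; rfl

theorem yuEval_surjective : Function.Surjective (yuEval C r q s) := by
  have hT : ∀ κ, ∃ f, yuEval C r q s f = yuT C r q s κ := fun κ =>
    ⟨MonoidAlgebra.of ℤ _ (κ, 1), by rw [yuEval_of]; simp⟩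
  have hL : ∀ x, ∃ f, yuEval C r q s f = yuLetter C r q s x := fun x =>
    ⟨MonoidAlgebra.of ℤ _ (1, FreeMonoid.of x), by rw [yuEval_of]; simp⟩
  have hle : Yu C r q s ≤ ((Yu C r q s).subtype.comp (yuEval C r q s)).range := by
    refine Subring.closure_le.2 ?_
    rintro x (((⟨i, l, rfl⟩ | ⟨i, l, rfl⟩) | ⟨l, rfl⟩) | ⟨l, rfl⟩)
    · obtain ⟨f, hf⟩ := hL (Sum.inl i, l)
      exact ⟨f, congrArg Subtype.val hf⟩
    · obtain ⟨f, hf⟩ := hL (Sum.inr i, l)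
      exact ⟨f, congrArg Subtype.val hf⟩
    · obtain ⟨f, hf⟩ := hT (Multiplicative.ofAdd (Finsupp.single l 1))
      exact ⟨f, congrArg Subtype.val (hf.trans (yuT_single C r q s l))⟩
    · obtain ⟨f, hf⟩ := hT (Multiplicative.ofAdd (Finsupp.single l (-1)))
      exact ⟨f, congrArg Subtype.val (hf.trans (yuT_single_neg C r q s l))⟩
  intro y
  obtain ⟨f, hf⟩ := hle y.2
  exact ⟨f, Subtype.ext hf⟩

/-- `t` as a unit of `Ŷ_t^s`. -/
noncomputable def ytT : (Yt C r q s)ˣ where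
  val := Yt.proj C r q s (Yu.t C r q s 0)
  inv := Yt.proj C r q s (Yu.tInv C r q s 0)
  val_inv := by
    rw [← map_mul, ← map_one (Yt.proj C r q s)]
    exact congrArg _ (Subtype.ext (Units.mul_inv _))
  inv_val := by
    rw [← map_mul, ← map_one (Yt.proj C r q s)]
    exact congrArg _ (Subtype.ext (Units.inv_mul _))

theorem proj_yuT (κ : Multiplicative (ZMod s →₀ ℤ)) :
    Yt.proj C r q s (yuT C r q s κ) = tSpecial (ytT C r q s) κ := by
  suffices h : (Yt.proj C r q s : Yu C r q s →* Yt C r q s).comp (yuT C r q s) =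
      tSpecial (ytT C r q s) from DFunLike.congr_fun h κ
  refine Finsupp.mulHom_ext' fun l => MonoidHom.ext_mint ?_
  change Yt.proj C r q s (yuT C r q s (Multiplicative.ofAdd (Finsupp.single l 1))) =
    ((ytT C r q s ^ (Finsupp.single l (1 : ℤ)) 0 : (Yt C r q s)ˣ) : Yt C r q s)
  rw [yuT_single]
  by_cases hl : l = 0
  · subst hl
    rw [Finsupp.single_eq_same, zpow_one]
    rfl
  · rw [Finsupp.single_eq_of_ne (Ne.symm hl), zpow_zero, Units.val_one, ← map_one (Yt.proj C r q s)]
    exact RingQuot.mkRingHom_rel (YtRel.t_eq_one l hl)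

variable {C r q s}

theorem tCommute_yt (hB : (symZ C r).IsSymm) (hs : IsPrimitiveRoot q s) :
    TCommute C r (ytT C r q s) fun x => Yt.proj C r q s (yuLetter C r q s x) := by
  refine ⟨fun x => ?_, fun x y => ?_⟩
  · refine Commute.map (f := Yt.proj C r q s) (x := Yu.t C r q s 0) ?_
    rw [← yuT_single]
    exact commute_yuT C r q s _ _
  · have h : yuLetter C r q s x * yuLetter C r q s y =
        yuT C r q s (Multiplicative.ofAdd (letterExp C r s x y)) *
          (yuLetter C r q s y * yuLetter C r q s x) := by
      refine Subtype.ext ?_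
      have := letter_mul_letter hB hs x y
      rw [← coe_yuLetter, ← coe_yuLetter] at this
      exact this
    rw [← map_mul, h, map_mul, map_mul, proj_yuT]
    rfl

/-- The subring `Ŷ_u^s` maps to every ring with the `t`-commutation relations, by the independence
of the monomials. -/
theorem exists_yu_lift (hB : (symZ C r).IsSymm) (hs : IsPrimitiveRoot q s)
    {R : Type*} [Ring R] {t : Rˣ} {b : Letter n s → R} (h : TCommute C r t b) :
    ∃ ψ : Yu C r q s →+* R, (∀ κ, ψ (yuT C r q s κ) = tSpecial t κ) ∧
      ∀ x, ψ (yuLetter C r q s x) = b x := by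
  let p : MonoidAlgebra ℤ (Monomials n s) →+* R :=
    (MonoidAlgebra.lift ℤ R (Monomials n s) (evalMonomial (tSpecial t) b h.commute_tSpecial) :
      _ →ₐ[ℤ] R)
  have hp : ∀ m : Monomials n s, p (MonoidAlgebra.of ℤ _ m) =
      tSpecial t m.1 * (m.2.toList.map b).prod := fun m =>
    (MonoidAlgebra.lift_of _ _).trans (evalMonomial_apply _ _ h.commute_tSpecial m)
  have hker : RingHom.ker (yuEval C r q s) ≤ RingHom.ker p := by
    intro f hf
    refine lift_tSpecial_eq_zero (q := q) hB hs h f ?_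
    rw [← coe_yuEval, RingHom.mem_ker.1 hf]
    rfl
  refine ⟨(yuEval C r q s).liftOfSurjective (yuEval_surjective C r q s) ⟨p, hker⟩, fun κ => ?_,
    fun x => ?_⟩
  · have h1 : yuT C r q s κ = yuEval C r q s (MonoidAlgebra.of ℤ _ (κ, 1)) := by
      rw [yuEval_of]; simp
    rw [h1]
    refine (RingHom.liftOfRightInverse_comp_apply _ _ _ _ _).trans ?_
    refine (hp _).trans ?_
    simp
  · have h1 : yuLetter C r q s x = yuEval C r q s (MonoidAlgebra.of ℤ _ (1, FreeMonoid.of x)) := by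
      rw [yuEval_of]; simp
    rw [h1]
    refine (RingHom.liftOfRightInverse_comp_apply _ _ _ _ _).trans ?_
    refine (hp _).trans ?_
    simp

end Subquotient

end TDeformed

open TDeformed in
theorem mainTheorem6 {n : ℕ} (C : Matrix (Fin n) (Fin n) ℤ) (hC : IsGenCartan C)
    (r : Fin n → ℕ) (hr : ∀ i, 0 < r i) (hB : (symZ C r).IsSymm)
    (q : ℂˣ) (s : ℕ) (hs : IsPrimitiveRoot q s) :
    ∃ φ : Pres C r s ≃+* Yt C r q s,
      (∀ (i : Fin n) (l : ZMod s),
        φ (Pres.of C r s (PresGen.Y i l)) = Yt.proj C r q s (Yu.Y C r q s i l)) ∧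
      (∀ (i : Fin n) (l : ZMod s),
        φ (Pres.of C r s (PresGen.Ainv i l)) = Yt.proj C r q s (Yu.Ainv C r q s i l)) ∧
      φ (Pres.of C r s PresGen.t) = Yt.proj C r q s (Yu.t C r q s 0) ∧
      φ (Pres.of C r s PresGen.tInv) = Yt.proj C r q s (Yu.tInv C r q s 0) := by
  obtain ⟨φ, hφ, hφt, hφt'⟩ := exists_pres_lift hC (tCommute_yt (q := q) (s := s) hB hs)
  obtain ⟨ψ₀, hψT, hψL⟩ := exists_yu_lift (q := q) hB hs (tCommute_pres (s := s) hC)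
  have hrel : ∀ ⦃x y⦄, YtRel C r q s x y → ψ₀ x = ψ₀ y := by
    rintro _ _ ⟨l, hl⟩
    rw [← yuT_single, hψT, map_one, tSpecial_apply, Finsupp.single_eq_of_ne (Ne.symm hl), zpow_zero,
      Units.val_one]
  let ψ : Yt C r q s →+* Pres C r s := RingQuot.lift ⟨ψ₀, hrel⟩
  have hψ : ∀ y, ψ (Yt.proj C r q s y) = ψ₀ y := fun y => RingQuot.lift_mkRingHom_apply _ _ _
  have hψφ : ψ.comp φ = RingHom.id _ := by
    refine pres_hom_ext (fun x => ?_) ?_ ?_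
    · rw [RingHom.comp_apply, hφ, hψ, hψL, RingHom.id_apply]
    · rw [RingHom.comp_apply, hφt]
      refine (hψ _).trans ?_
      rw [← yuT_single, hψT, tSpecial_apply, Finsupp.single_eq_same, zpow_one]
      rfl
    · rw [RingHom.comp_apply, hφt']
      refine (hψ _).trans ?_
      rw [← yuT_single_neg, hψT, tSpecial_apply, Finsupp.single_eq_same, zpow_neg_one]
      rfl
  -- `φ ψ = id` holds on the monomials, which span `Ŷ_t^s`.
  have hφT : ∀ κ : Multiplicative (ZMod s →₀ ℤ), φ (tSpecial (presT C r s) κ) = tSpecial (ytT C r q s) κ := by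
    intro κ
    have hu : Units.map (φ : Pres C r s →* Yt C r q s) (presT C r s) = ytT C r q s :=
      Units.ext hφt
    change φ ((presT C r s ^ κ.toAdd 0 : (Pres C r s)ˣ) : Pres C r s) =
      ((ytT C r q s ^ κ.toAdd 0 : (Yt C r q s)ˣ) : Yt C r q s)
    rw [← hu, ← map_zpow]
    rfl
  have hφψ : φ.comp ψ = RingHom.id _ := by
    refine RingQuot.ringQuot_ext _ _ (RingHom.ext fun y => ?_)
    obtain ⟨f, rfl⟩ := yuEval_surjective C r q s y
    change φ (ψ (Yt.proj C r q s _)) = Yt.proj C r q s _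
    rw [hψ]
    induction f using MonoidAlgebra.induction_on with
    | of m =>
      rw [yuEval_of, map_mul, map_mul, map_mul, hψT, hφT, proj_yuT, map_list_prod, map_list_prod,
        map_list_prod, List.map_map, List.map_map, List.map_map]
      congr 3
      funext x
      exact (congrArg φ (hψL x)).trans (hφ x)
    | add f g hf hg => simp only [map_add, hf, hg]
    | smul a f hf => simp only [map_zsmul, hf]
  exact ⟨RingEquiv.ofRingHom φ ψ hφψ hψφ, fun i l => hφ (Sum.inl i, l),
    fun i l => hφ (Sum.inr i, l), hφt, hφt'⟩
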